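/- Let $H$ be a semisimple Hopf algebra over $\mathbb{C}$, with comultiplication $\Delta(h)=h_1\otimes h_2$, counit $\epsilon$ and antipode $S$, and let $M$ be an $H$-module. *The kernel of $M$.* An irreducible character of $H^*$ is an element $d=\sum_i x_{ii}\in H$, where $(x_{ij})_{1\le i,j\le q}$, $q\ge 1$, is a linearly independent family in $H$ with $\Delta(x_{ij})=\sum_l x_{il}\otimes x_{lj}$ and $\epsilon(x_{ij})=\delta_{ij}$ (a comatrix basis of a simple subcoalgebra of $H$). Let $\ker_H(M)$ be the set of all such $d$ for which $x_{ij}m=\delta_{ij}m$ for all $i,j$ and all $m\in M$. The kernel $H_M$ of the representation $M$ is the Hopf subalgebra of $H$ generated by $\ker_H(M)$, i.e. the smallest Hopf subalgebra containing it. *The ideal $I_M$.* Let $I_M=\bigcap_{n\ge 0}\mathrm{Ann}_H(M^{\otimes n})$, where $H$ acts on tensor powers through $\Delta$ and $M^{\otimes 0}=\mathbb{C}$ is the trivial module (action through $\epsilon$). *The Hopf kernel.* For a map $f:A\to B$ of Hopf algebras, let $$\mathrm{HKer}(f)=\{a\in A \mid a_1\otimes f(a_2)\otimes a_3=a_1\otimes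 f(1)\otimes a_2\}\subseteq A .$$ **Theorem 2.10.** $I_M$ is a (two-sided) Hopf ideal of $H$, it is the largest Hopf ideal contained in $\mathrm{Ann}_H(M)$, and, with $\pi:H\to H/I_M$ the canonical projection, $$H_M=\mathrm{HKer}(\pi).$$ -/

import Mathlib

open scoped TensorProduct

universe u v

/-- A complex representation of a `ℂ`-algebra `H`, as a bundled object: a complex vector space
with an algebra homomorphism from `H` to its linear endomorphisms. -/
structure AlgRep (H : Type u) [Ring H] [Algebra ℂ H] where
  carrier : Type v
  [addCommGroup : AddCommGroup carrier]
  [module : Module ℂ carrier]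
  ρ : H →ₐ[ℂ] Module.End ℂ carrier

namespace AlgRep

attribute [instance] AlgRep.addCommGroup AlgRep.module

/-- An `H`-module, seen as a representation. -/
def ofModule (H : Type u) [Ring H] [Algebra ℂ H] (M : Type v) [AddCommGroup M] [Module ℂ M]
    [Module H M] [IsScalarTower ℂ H M] : AlgRep.{u, v} H where
  carrier := M
  ρ := Algebra.lsmul ℂ ℂ M

/-- The annihilator of a representation. -/
def ann {H : Type u} [Ring H] [Algebra ℂ H] (V : AlgRep.{u, v} H) : Ideal H :=
  RingHom.ker V.ρ

variable {H : Type u} [Ring H] [Bialgebra ℂ H]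

/-- The action of `H` on the trivial representation: `h` acts as the scalar `ε(h)`. -/
noncomputable def trivialAction (H : Type u) [Ring H] [Bialgebra ℂ H] (V : Type v)
    [AddCommGroup V] [Module ℂ V] : H →ₐ[ℂ] Module.End ℂ V :=
  (Algebra.ofId ℂ (Module.End ℂ V)).comp (Bialgebra.counitAlgHom ℂ H)

/-- The action of `H` on a tensor product: `h (v ⊗ w) = h₁ v ⊗ h₂ w`. -/
noncomputable def tensorAction {V W : Type v} [AddCommGroup V] [Module ℂ V] [AddCommGroup W]
    [Module ℂ W] (ρ : H →ₐ[ℂ] Module.End ℂ V) (σ : H →ₐ[ℂ] Module.End ℂ W) :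
    H →ₐ[ℂ] Module.End ℂ (V ⊗[ℂ] W) :=
  (Module.endTensorEndAlgHom (R := ℂ) (S := ℂ) (A := ℂ) (M := V) (N := W)).comp
    ((Algebra.TensorProduct.map ρ σ).comp (Bialgebra.comulAlgHom ℂ H))

/-- The trivial one-dimensional representation. -/
noncomputable def trivial (H : Type u) [Ring H] [Bialgebra ℂ H] : AlgRep.{u, v} H where
  carrier := ULift.{v} ℂ
  ρ := trivialAction H (ULift.{v} ℂ)

/-- The tensor product of two representations. -/
noncomputable def tensor (V W : AlgRep.{u, v} H) : AlgRep.{u, v} H where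
  carrier := V.carrier ⊗[ℂ] W.carrier
  ρ := tensorAction V.ρ W.ρ

/-- The tensor powers of a representation; the zeroth one is the trivial representation. -/
noncomputable def pow (V : AlgRep.{u, v} H) : ℕ → AlgRep.{u, v} H
  | 0 => trivial H
  | n + 1 => V.tensor (pow V n)

end AlgRep

/-- The ideal `I_M = ⋂ₙ Ann_H(M^{⊗n})`, the intersection being over all `n ≥ 0`. -/
noncomputable def tensorAnn (H : Type u) [Ring H] [Bialgebra ℂ H] (M : Type v) [AddCommGroup M]
    [Module ℂ M] [Module H M] [IsScalarTower ℂ H M] : Ideal H :=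
  ⨅ n : ℕ, ((AlgRep.ofModule H M).pow n).ann

/-- `x = (x i j)` is a comatrix basis (of a simple subcoalgebra of `H`): its entries are linearly
independent, `Δ(x i j) = ∑ l, x i l ⊗ x l j` and `ε(x i j) = δ i j`. -/
structure IsComatrixBasis {H : Type u} [Ring H] [Bialgebra ℂ H] {q : ℕ}
    (x : Matrix (Fin q) (Fin q) H) : Prop where
  linearIndependent : LinearIndependent ℂ (fun p : Fin q × Fin q => x p.1 p.2)
  comul_eq : ∀ i j, Coalgebra.comul (R := ℂ) (x i j) = ∑ l, x i l ⊗ₜ[ℂ] x l j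
  counit_eq : ∀ i j, Coalgebra.counit (R := ℂ) (x i j) = if i = j then 1 else 0

/-- The set `ker_H(χ)`, for `χ` the character of `M`: all irreducible characters `d` of `H^*`,
that is, all traces `d = ∑ i, x i i` of comatrix bases `x` of simple subcoalgebras of `H`, such
that `x i j` acts on `M` as the scalar `δ i j` for all `i, j`. -/
def kerChar (H : Type u) [Ring H] [Bialgebra ℂ H] (M : Type v) [AddCommGroup M]
    [Module H M] : Set H :=
  {d | ∃ (q : ℕ) (x : Matrix (Fin q) (Fin q) H), 0 < q ∧ IsComatrixBasis x ∧ d = x.trace ∧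
    ∀ i j, ∀ m : M, x i j • m = if i = j then m else 0}

/-- A subalgebra `K` of `H` is a Hopf subalgebra if `Δ(K) ⊆ K ⊗ K` and `S(K) ⊆ K`. -/
structure IsHopfSubalgebra {H : Type u} [Ring H] [HopfAlgebra ℂ H] (K : Subalgebra ℂ H) :
    Prop where
  comul_mem : ∀ a ∈ K, Coalgebra.comul (R := ℂ) a ∈
    LinearMap.range (TensorProduct.map (Subalgebra.toSubmodule K).subtype
      (Subalgebra.toSubmodule K).subtype)
  antipode_mem : ∀ a ∈ K, HopfAlgebra.antipode ℂ a ∈ K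

/-- The kernel `H_M` of the representation `M`: the Hopf subalgebra of `H` generated by the
irreducible characters in `ker_H(χ)`, i.e. the smallest one containing them. -/
noncomputable def repKer (H : Type u) [Ring H] [HopfAlgebra ℂ H] (M : Type v) [AddCommGroup M]
    [Module H M] : Subalgebra ℂ H :=
  sInf {K | IsHopfSubalgebra K ∧ kerChar H M ⊆ K}

section HopfKer

variable {A B : Type*} [Ring A] [Ring B] [Bialgebra ℂ A] [Bialgebra ℂ B]

/-- The algebra map `a ↦ a₁ ⊗ f(a₂) ⊗ a₃`. -/
noncomputable def comulMid (f : A →ₐc[ℂ] B) : A →ₐ[ℂ] A ⊗[ℂ] (B ⊗[ℂ] A) :=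
  (Algebra.TensorProduct.map (AlgHom.id ℂ A)
    ((Algebra.TensorProduct.map (f : A →ₐ[ℂ] B) (AlgHom.id ℂ A)).comp
      (Bialgebra.comulAlgHom ℂ A))).comp (Bialgebra.comulAlgHom ℂ A)

/-- The algebra map `a ↦ a₁ ⊗ 1 ⊗ a₂`. -/
noncomputable def comulOne (A B : Type*) [Ring A] [Ring B] [Bialgebra ℂ A] [Bialgebra ℂ B] :
    A →ₐ[ℂ] A ⊗[ℂ] (B ⊗[ℂ] A) :=
  (Algebra.TensorProduct.map (AlgHom.id ℂ A)
    (Algebra.TensorProduct.includeRight : A →ₐ[ℂ] B ⊗[ℂ] A)).comp (Bialgebra.comulAlgHom ℂ A)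

/-- The Hopf kernel `HKer(f) = {a | a₁ ⊗ f(a₂) ⊗ a₃ = a₁ ⊗ f(1) ⊗ a₂}` of a map of Hopf
algebras. Note that `f(1) = 1`. -/
noncomputable def hopfKer (f : A →ₐc[ℂ] B) : Subalgebra ℂ A :=
  AlgHom.equalizer (comulMid f) (comulOne A B)

end HopfKer

/-!
The proof has two independent halves, tied together by the convolution algebra
`H^* = WithConv (H →ₗ[ℂ] ℂ)` and its two actions `f ⇀ x = x₁ f(x₂)` (`hitLeft`) and
`x ↼ f = f(x₁) x₂` (`hitRight`) on `H`. Identities between elements of `H` are tested on functionals,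
which turns coassociativity into associativity of `H^*`.

*The ideal.* Since functionals `ℓ ⊗ ℓ'` separate the points of a tensor product, `I_M` is the common
zero set of all convolution products of matrix coefficients of `M`
(`mem_tensorAnn_iff_coeffMonoid`). That these products are closed under multiplication makes `I_M` a
coideal. A coideal in `Ann(M)` kills every `M^{⊗n}` by induction on `n`, so `I_M` is the largest one.
Stability under `S` is automatic in finite dimension: `S` is the convolution inverse of the identity,
and a subalgebra of a finite-dimensional algebra is closed under inverses
(`antipode_mem_of_mul_mem`). The same argument makes the sub-bialgebra `HKer(π)` a Hopf subalgebra.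

*The Hopf kernel.* An element `a` lies in `HKer(π)` iff `π = ε` on the subcoalgebra generated by `a`
(`mem_hopfKer_iff`). So a comatrix basis lies in `HKer(π)` iff it acts on `M` as the identity matrix,
which gives `H_M ≤ HKer(π)`. The reverse inclusion needs `HKer(π)` to be spanned by comatrix bases,
that is, the theorem of Larson and Radford that the semisimple `H` is cosemisimple. Here it is proved
as follows. Semisimplicity gives a two-sided integral `Λ` with `ε(Λ) = 1`; its tensor legs span `H`,
so `H` is finite-dimensional. The functional `λ(x) = Tr(h ↦ S²(h) x)` is a right integral of `H^*`
with `λ(Λ) = 1` and `λ(1) = Tr(S²)`. The form `λ(xy)` is nondegenerate with Nakayama automorphism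
`S²` (`integral_mul_comm`), and `S⁴` is conjugation by the grouplike element `g = Λ₁ λ(Λ₂)`
(`antipode_pow_four_mul`), which has finite order. Writing `λ(x) = tr(u x)` on `H ≅ ∏ Mat(ℂ)`, `S²`
is conjugation by `u⁻¹` and `u² g` is central. On each factor, `u` is thus a scalar times a matrix
`v` of finite order, so that `Tr(S²) = ∑ tr(v⁻¹) tr(v) = ∑ |tr v|²`. This is positive, for otherwise
`tr(u z) = 0` for all central `z`, while `tr(u Λ) = 1`. Hence `λ` can be normalized to `λ(1) = 1`, and
averaging over `λ(S(x) y)` makes `H^*` semisimple (`isSemisimpleRing_dual`). The matrix entries of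
`H^* ≅ ∏ Mat(ℂ)` are comatrix bases spanning `H`, and any subspace stable under both actions is
spanned by those it contains (`mem_span_comatrix`).
-/

open Coalgebra WithConv LinearMap

/-! ### Testing tensors and vectors on functionals -/

section DualTest

variable {k V W : Type*} [Field k] [AddCommGroup V] [Module k V] [AddCommGroup W] [Module k W]

theorem tensor_eq_zero_of_dual {t : V ⊗[k] W}
    (h : ∀ (f : V →ₗ[k] k) (g : W →ₗ[k] k), mul' k k (TensorProduct.map f g t) = 0) : t = 0 := by
  let b := Module.Basis.ofVectorSpace k V
  let c := Module.Basis.ofVectorSpace k W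
  apply (b.tensorProduct c).repr.injective
  ext ⟨i, j⟩
  have : (Finsupp.lapply (i, j)) ∘ₗ (b.tensorProduct c).repr.toLinearMap =
      mul' k k ∘ₗ TensorProduct.map (b.coord i) (c.coord j) := by
    ext v w
    simp [mul_comm]
  simpa using (LinearMap.congr_fun this t).trans (h _ _)

theorem tensor_eq_of_dual {t s : V ⊗[k] W}
    (h : ∀ (f : V →ₗ[k] k) (g : W →ₗ[k] k),
      mul' k k (TensorProduct.map f g t) = mul' k k (TensorProduct.map f g s)) : t = s :=
  sub_eq_zero.mp <| tensor_eq_zero_of_dual fun f g => by simp [h f g]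

theorem eq_of_forall_dual {x y : V} (h : ∀ f : V →ₗ[k] k, f x = f y) : x = y :=
  sub_eq_zero.mp <| (Module.forall_dual_apply_eq_zero_iff k _).mp fun f => by simp [h f]

theorem apply_rid_lTensor (f : W →ₗ[k] k) (g : V →ₗ[k] k) (t : V ⊗[k] W) :
    g (TensorProduct.rid k V (lTensor V f t)) = mul' k k (TensorProduct.map g f t) := by
  have : g ∘ₗ (TensorProduct.rid k V).toLinearMap ∘ₗ lTensor V f =
      mul' k k ∘ₗ TensorProduct.map g f := by
    ext x y
    simp [mul_comm]
  exact LinearMap.congr_fun this t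

theorem apply_lid_rTensor (f : V →ₗ[k] k) (g : W →ₗ[k] k) (t : V ⊗[k] W) :
    g (TensorProduct.lid k W (rTensor W f t)) = mul' k k (TensorProduct.map f g t) := by
  have : g ∘ₗ (TensorProduct.lid k W).toLinearMap ∘ₗ rTensor W f =
      mul' k k ∘ₗ TensorProduct.map f g := by
    ext x y
    simp
  exact LinearMap.congr_fun this t

variable (k) in
theorem eq_of_forall_conv {x y : V} (h : ∀ f : WithConv (V →ₗ[k] k), f x = f y) : x = y :=
  eq_of_forall_dual fun f => h (toConv f)

theorem exists_dual_of_linearIndependent {ι : Type*} [DecidableEq ι]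
    {w : ι → V} (hw : LinearIndependent k w) (i : ι) :
    ∃ f : V →ₗ[k] k, ∀ j, f (w j) = if j = i then 1 else 0 := by
  obtain ⟨g, hg⟩ := (Finsupp.linearCombination k w).exists_leftInverse_of_injective
    (LinearMap.ker_eq_bot.mpr hw)
  refine ⟨Finsupp.lapply i ∘ₗ g, fun j => ?_⟩
  have := LinearMap.congr_fun hg (Finsupp.single j 1)
  rw [comp_apply, Finsupp.linearCombination_single, one_smul] at this
  rw [comp_apply, this]
  simp [Finsupp.single_apply]

end DualTest

/-! ### The actions of the convolution algebra on a coalgebra -/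

section Hit

variable {k C : Type*} [Field k] [AddCommGroup C] [Module k C] [Coalgebra k C]

/-- The left action `f ⇀ x = x₁ f(x₂)` of the convolution algebra on its coalgebra. -/
noncomputable def hitLeft (f : WithConv (C →ₗ[k] k)) : C →ₗ[k] C :=
  (TensorProduct.rid k C).toLinearMap ∘ₗ lTensor C f.ofConv ∘ₗ comul

/-- The right action `x ↼ f = f(x₁) x₂` of the convolution algebra on its coalgebra. -/
noncomputable def hitRight (f : WithConv (C →ₗ[k] k)) : C →ₗ[k] C :=
  (TensorProduct.lid k C).toLinearMap ∘ₗ rTensor C f.ofConv ∘ₗ comul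

theorem apply_hitLeft (f g : WithConv (C →ₗ[k] k)) (x : C) : g (hitLeft f x) = (g * f) x :=
  apply_rid_lTensor _ _ _

theorem apply_hitRight (f g : WithConv (C →ₗ[k] k)) (x : C) : g (hitRight f x) = (f * g) x :=
  apply_lid_rTensor _ _ _

theorem hitLeft_hitLeft (f g : WithConv (C →ₗ[k] k)) (x : C) :
    hitLeft f (hitLeft g x) = hitLeft (f * g) x := by
  refine eq_of_forall_conv k fun h => ?_
  simp only [apply_hitLeft, mul_assoc]

theorem hitRight_hitRight (f g : WithConv (C →ₗ[k] k)) (x : C) :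
    hitRight f (hitRight g x) = hitRight (g * f) x := by
  refine eq_of_forall_conv k fun h => ?_
  simp only [apply_hitRight, mul_assoc]

theorem hitLeft_hitRight (f g : WithConv (C →ₗ[k] k)) (x : C) :
    hitLeft f (hitRight g x) = hitRight g (hitLeft f x) := by
  refine eq_of_forall_conv k fun h => ?_
  simp only [apply_hitRight, apply_hitLeft, mul_assoc]

theorem hitLeft_one (x : C) : hitLeft (1 : WithConv (C →ₗ[k] k)) x = x := by
  refine eq_of_forall_conv k fun h => ?_
  rw [apply_hitLeft, mul_one]

theorem hitRight_one (x : C) : hitRight (1 : WithConv (C →ₗ[k] k)) x = x := by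
  refine eq_of_forall_conv k fun h => ?_
  rw [apply_hitRight, one_mul]

/-- A subspace stable under both actions of the convolution algebra is a subcoalgebra. -/
theorem comul_mem_of_hit_mem {K : Submodule k C} (hl : ∀ f : WithConv (C →ₗ[k] k), ∀ a ∈ K, hitLeft f a ∈ K)
    (hr : ∀ f : WithConv (C →ₗ[k] k), ∀ a ∈ K, hitRight f a ∈ K) {a : C} (ha : a ∈ K) :
    comul (R := k) a ∈ LinearMap.range (TensorProduct.map K.subtype K.subtype) := by
  -- for a projection `p` onto `K`, the tensor `(p ⊗ p) Δ(a)` has the same functionals as `Δ(a)`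
  obtain ⟨p, hp⟩ := K.subtype.exists_leftInverse_of_injective K.ker_subtype
  have hpK : ∀ x ∈ K, (p x : C) = x := fun x hx =>
    congrArg Subtype.val (LinearMap.congr_fun hp ⟨x, hx⟩)
  refine ⟨TensorProduct.map p p (comul a), tensor_eq_of_dual fun f g => ?_⟩
  have h1 := fun x hx => congrArg f (hpK x hx)
  have h2 := fun x hx => congrArg g (hpK x hx)
  set F : WithConv (C →ₗ[k] k) := toConv (f ∘ₗ K.subtype ∘ₗ p)
  set G : WithConv (C →ₗ[k] k) := toConv (g ∘ₗ K.subtype ∘ₗ p)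
  have e : mul' k k (TensorProduct.map f g (TensorProduct.map K.subtype K.subtype
      (TensorProduct.map p p (comul a)))) = (F * G) a := by
    simp [F, G, TensorProduct.map_comp]
  rw [e]
  calc (F * G) a = F (hitLeft G a) := (apply_hitLeft _ _ _).symm
    _ = (toConv f : WithConv (C →ₗ[k] k)) (hitLeft G a) := h1 _ (hl _ _ ha)
    _ = G (hitRight (toConv f) a) := by rw [apply_hitLeft, apply_hitRight]
    _ = (toConv g : WithConv (C →ₗ[k] k)) (hitRight (toConv f) a) := h2 _ (hr _ _ ha)
    _ = _ := by rw [apply_hitRight]; rfl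

theorem hitRight_mem_of_comul_mem {K : Submodule k C} {a : C}
    (h : comul (R := k) a ∈ LinearMap.range (TensorProduct.map K.subtype K.subtype))
    (f : WithConv (C →ₗ[k] k)) : hitRight f a ∈ K := by
  obtain ⟨t, ht⟩ := h
  rw [hitRight, comp_apply, comp_apply, ← ht]
  clear ht
  induction t with
  | zero => simp
  | tmul x y => simpa using K.smul_mem _ y.2
  | add x y hx hy => simpa using K.add_mem hx hy

end Hit

/-! ### The antipode and the comultiplication -/

section Antipode

open Algebra.TensorProduct (includeLeft includeRight)
open HopfAlgebra (antipode)

variable {k H : Type*} [Field k] [Ring H] [HopfAlgebra k H]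

variable (k H) in
/-- The map `x ↦ x ⊗ 1`, in the convolution algebra of linear maps `H → H ⊗ H`. -/
noncomputable def convLeft : WithConv (H →ₗ[k] H ⊗[k] H) :=
  toConv (includeLeft : H →ₐ[k] H ⊗[k] H).toLinearMap

variable (k H) in
/-- The map `x ↦ 1 ⊗ x`, in the convolution algebra of linear maps `H → H ⊗ H`. -/
noncomputable def convRight : WithConv (H →ₗ[k] H ⊗[k] H) :=
  toConv (includeRight : H →ₐ[k] H ⊗[k] H).toLinearMap

theorem convLeft_apply (x : H) : convLeft k H x = x ⊗ₜ 1 := rfl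

theorem convRight_apply (x : H) : convRight k H x = 1 ⊗ₜ x := rfl

/-- `S(x₁)x₂ ⊗ x₃ = 1 ⊗ x`. -/
theorem convLeft_antipode_mul_comul :
    toConv ((convLeft k H).ofConv ∘ₗ antipode k) * toConv (comul (R := k) (A := H)) =
      convRight k H := by
  ext x
  have key : ∀ t : H ⊗[k] H, mul' k (H ⊗[k] H)
      (TensorProduct.map ((convLeft k H).ofConv ∘ₗ antipode k) comul t) =
      rTensor H (mul' k H ∘ₗ rTensor H (antipode k))
        ((TensorProduct.assoc k H H H).symm (lTensor H comul t)) := by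
    intro t
    induction t with
    | zero => simp
    | add s t hs ht => simp only [map_add, hs, ht]
    | tmul u y =>
      simp only [TensorProduct.map_tmul, lTensor_tmul, mul'_apply]
      generalize (comul y : H ⊗[k] H) = s
      induction s with
      | zero => simp
      | add s t hs ht => simp only [TensorProduct.tmul_add, map_add, mul_add, hs, ht]
      | tmul v w => simp [convLeft_apply]
  refine (key (comul x)).trans ?_
  rw [coassoc_symm_apply, ← rTensor_comp_apply, comp_assoc,
    HopfAlgebra.mul_antipode_rTensor_comul, rTensor_comp_apply, rTensor_counit_comul]
  simp [convRight_apply]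

/-- `x₁ ⊗ x₂ S(x₃) = x ⊗ 1`. -/
theorem comul_mul_convRight_antipode :
    toConv (comul (R := k) (A := H)) * toConv ((convRight k H).ofConv ∘ₗ antipode k) =
      convLeft k H := by
  ext x
  have key : ∀ t : H ⊗[k] H, mul' k (H ⊗[k] H)
      (TensorProduct.map comul ((convRight k H).ofConv ∘ₗ antipode k) t) =
      lTensor H (mul' k H ∘ₗ lTensor H (antipode k))
        ((TensorProduct.assoc k H H H) (rTensor H comul t)) := by
    intro t
    induction t with
    | zero => simp
    | add s t hs ht => simp only [map_add, hs, ht]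
    | tmul y u =>
      simp only [TensorProduct.map_tmul, rTensor_tmul, mul'_apply]
      generalize (comul y : H ⊗[k] H) = s
      induction s with
      | zero => simp
      | add s t hs ht => simp only [TensorProduct.add_tmul, map_add, add_mul, hs, ht]
      | tmul v w => simp [convRight_apply]
  refine (key (comul x)).trans ?_
  rw [coassoc_apply, ← lTensor_comp_apply, comp_assoc,
    HopfAlgebra.mul_antipode_lTensor_comul, lTensor_comp_apply, lTensor_counit_comul]
  simp [convLeft_apply]

/-- `(1 ⊗ x₁) Δ(S x₂) = S(x) ⊗ 1`. -/
theorem convRight_mul_comul_antipode :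
    convRight k H * toConv (comul (R := k) (A := H) ∘ₗ antipode k) =
      toConv ((convLeft k H).ofConv ∘ₗ antipode k) := by
  rw [← convLeft_antipode_mul_comul, mul_assoc, comul_right_inv, mul_one]

/-- The antipode reverses the comultiplication, `Δ(S x) = S(x₂) ⊗ S(x₁)`, here with the right
side written as the convolution product of `x ↦ 1 ⊗ S(x)` and `x ↦ S(x) ⊗ 1`. -/
theorem comul_comp_antipode :
    toConv (comul (R := k) (A := H) ∘ₗ antipode k) =
      toConv ((convRight k H).ofConv ∘ₗ antipode k) *
        toConv ((convLeft k H).ofConv ∘ₗ antipode k) := by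
  have h : toConv ((convRight k H).ofConv ∘ₗ antipode k) * convRight k H = 1 := by
    have := congrArg (fun f : WithConv (H →ₗ[k] H) =>
      toConv ((includeRight : H →ₐ[k] H ⊗[k] H).toLinearMap ∘ₗ f.ofConv))
      (antipode_mul_id (R := k) (C := H))
    simp only [algHom_comp_convMul_distrib] at this
    refine this.trans ?_
    ext x
    simp [LinearMap.convOne_def, Algebra.algebraMap_eq_smul_one, Algebra.TensorProduct.one_def]
  rw [← convRight_mul_comul_antipode, ← mul_assoc, h, one_mul]

theorem comul_antipode (x : H) :
    comul (R := k) (antipode k x) =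
      TensorProduct.map (antipode k) (antipode k) (TensorProduct.comm k H H (comul x)) := by
  have h := congrArg (fun f : WithConv (H →ₗ[k] H ⊗[k] H) => f x) (comul_comp_antipode (k := k))
  refine h.trans ?_
  rw [← (ℛ k x).eq, (ℛ k x).convMul_apply]
  simp [convRight_apply, convLeft_apply]

/-- If `Λ x = ε(x) Λ` for all `x`, then `Λ₁ x ⊗ Λ₂ = Λ₁ ⊗ Λ₂ S(x)`. -/
theorem comul_mul_tmul_one {Λ : H} (hΛ : ∀ x, Λ * x = counit (R := k) x • Λ) (x : H) :
    comul (R := k) Λ * (x ⊗ₜ[k] 1) = comul Λ * (1 ⊗ₜ antipode k x) := by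
  have h := congrArg (fun f : WithConv (H →ₗ[k] H ⊗[k] H) => f x)
    (comul_mul_convRight_antipode (k := k))
  simp only [convLeft_apply] at h
  rw [← h, (ℛ k x).convMul_apply, Finset.mul_sum]
  conv_rhs => rw [← sum_counit_smul (ℛ k x)]
  simp only [map_sum, map_smul, TensorProduct.tmul_sum, Finset.mul_sum]
  refine Finset.sum_congr rfl fun i _ => ?_
  rw [← mul_assoc, ofConv_toConv, ← Bialgebra.comul_mul, hΛ, map_smul]
  simp [convRight_apply]

/-- If `x Λ = ε(x) Λ` for all `x`, then `S(x) Λ₁ ⊗ Λ₂ = Λ₁ ⊗ x Λ₂`. -/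
theorem tmul_one_mul_comul {Λ : H} (hΛ : ∀ x, x * Λ = counit (R := k) x • Λ) (x : H) :
    (antipode k x ⊗ₜ[k] 1) * comul (R := k) Λ = (1 ⊗ₜ x) * comul Λ := by
  have h := congrArg (fun f : WithConv (H →ₗ[k] H ⊗[k] H) => f x)
    (convLeft_antipode_mul_comul (k := k))
  simp only [convRight_apply] at h
  rw [← h, (ℛ k x).convMul_apply, Finset.sum_mul]
  have e : x = ∑ i ∈ (ℛ k x).index, counit (R := k) ((ℛ k x).right i) • (ℛ k x).left i := by
    have := congrArg (TensorProduct.rid k H) (sum_tmul_counit_eq (ℛ k x))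
    simp only [map_sum, TensorProduct.rid_tmul, one_smul] at this
    exact this.symm
  conv_lhs => rw [e]
  simp only [map_sum, map_smul, TensorProduct.sum_tmul, Finset.sum_mul]
  refine Finset.sum_congr rfl fun i _ => ?_
  rw [mul_assoc, ofConv_toConv, ← Bialgebra.comul_mul, hΛ, map_smul]
  simp [convLeft_apply, ← TensorProduct.smul_tmul']

end Antipode

/-! ### Integrals and finite-dimensionality -/

section Integral

open HopfAlgebra (antipode)

variable {k H : Type*} [Field k] [Ring H] [HopfAlgebra k H]

variable (k H) in
/-- A semisimple Hopf algebra has a two-sided integral `Λ` with `ε(Λ) = 1`. -/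
theorem exists_integral [IsSemisimpleRing H] :
    ∃ Λ : H, counit (R := k) Λ = 1 ∧ (∀ x, x * Λ = counit (R := k) x • Λ) ∧
      ∀ x, Λ * x = counit (R := k) x • Λ := by
  let P : Ideal H := RingHom.ker (Bialgebra.counitAlgHom k H)
  have hP : ∀ x, x ∈ P ↔ counit (R := k) x = 0 := fun x => RingHom.mem_ker
  obtain ⟨N, hN⟩ := exists_isCompl P
  obtain ⟨a, ha, Λ, hΛN, haΛ⟩ := Submodule.mem_sup.mp
    (hN.sup_eq_top ▸ Submodule.mem_top : (1 : H) ∈ P ⊔ N)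
  have hε : counit (R := k) Λ = 1 := by
    rw [eq_sub_of_add_eq' haΛ, map_sub, Bialgebra.counit_one, (hP a).mp ha, sub_zero]
  have hP0 : ∀ x ∈ P, x * Λ = 0 := fun x hx => by
    refine (Submodule.disjoint_def.mp hN.disjoint) _ ?_ (N.mul_mem_left x hΛN)
    rw [hP, Bialgebra.counit_mul, (hP x).mp hx, zero_mul]
  have hl : ∀ x, x * Λ = counit (R := k) x • Λ := fun x => by
    have := hP0 (x - algebraMap k H (counit x)) (by simp [hP])
    rwa [sub_mul, sub_eq_zero, ← Algebra.smul_def] at this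
  refine ⟨Λ, hε, hl, ?_⟩
  have hr0 : ∀ x ∈ P, Λ * x = 0 := fun x hx => by
    -- `Λ x` generates a one-dimensional left ideal of square zero
    have hsq : ∀ y, Λ * x * (y * (Λ * x)) = 0 := fun y => by
      rw [← mul_assoc y, hl, smul_mul_assoc, mul_smul_comm, mul_assoc, ← mul_assoc x, hP0 x hx,
        zero_mul, mul_zero, smul_zero]
    obtain ⟨Q, hQ⟩ := exists_isCompl (Ideal.span {Λ * x})
    obtain ⟨b, hb, c, hc, hbc⟩ := Submodule.mem_sup.mp
      (hQ.sup_eq_top ▸ Submodule.mem_top : (1 : H) ∈ Ideal.span {Λ * x} ⊔ Q)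
    obtain ⟨y, rfl⟩ := Ideal.mem_span_singleton'.mp hb
    have h1 : Λ * x = Λ * x * c := by
      conv_lhs => rw [← mul_one (Λ * x), ← hbc, mul_add, hsq, zero_add]
    refine (Submodule.disjoint_def.mp hQ.disjoint) _ (Ideal.subset_span rfl) ?_
    rw [h1]
    exact Q.mul_mem_left _ hc
  intro x
  have := hr0 (x - algebraMap k H (counit x)) (by simp [hP])
  rwa [mul_sub, sub_eq_zero, ← Algebra.commutes, ← Algebra.smul_def] at this

theorem rid_lTensor_mul_tmul_one (f : H →ₗ[k] k) (t : H ⊗[k] H) (x : H) :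
    TensorProduct.rid k H (lTensor H f (t * (x ⊗ₜ 1))) =
      TensorProduct.rid k H (lTensor H f t) * x := by
  induction t with
  | zero => simp
  | tmul u v => simp
  | add s t hs ht => simp only [add_mul, map_add, hs, ht]

theorem rid_lTensor_tmul_one_mul (f : H →ₗ[k] k) (t : H ⊗[k] H) (x : H) :
    TensorProduct.rid k H (lTensor H f ((x ⊗ₜ 1) * t)) =
      x * TensorProduct.rid k H (lTensor H f t) := by
  induction t with
  | zero => simp
  | tmul u v => simp
  | add s t hs ht => simp only [mul_add, map_add, hs, ht]

theorem rid_lTensor_mul_one_tmul (f : H →ₗ[k] k) (t : H ⊗[k] H) (x : H) :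
    TensorProduct.rid k H (lTensor H f (t * (1 ⊗ₜ x))) =
      TensorProduct.rid k H (lTensor H (f ∘ₗ mulRight k x) t) := by
  induction t with
  | zero => simp
  | tmul u v => simp
  | add s t hs ht => simp only [add_mul, map_add, hs, ht]

theorem rid_lTensor_one_tmul_mul (f : H →ₗ[k] k) (t : H ⊗[k] H) (x : H) :
    TensorProduct.rid k H (lTensor H f ((1 ⊗ₜ x) * t)) =
      TensorProduct.rid k H (lTensor H (f ∘ₗ mulLeft k x) t) := by
  induction t with
  | zero => simp
  | tmul u v => simp
  | add s t hs ht => simp only [mul_add, map_add, hs, ht]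

/-- `(Λ₁ f(Λ₂)) x = Λ₁ f(Λ₂ S(x))` for a right integral `Λ`. -/
theorem hitLeft_mul {Λ : H} (hr : ∀ x, Λ * x = counit (R := k) x • Λ)
    (f : WithConv (H →ₗ[k] k)) (x : H) :
    hitLeft f Λ * x = hitLeft (toConv (f.ofConv ∘ₗ mulRight k (antipode k x))) Λ := by
  have := congrArg (fun t => TensorProduct.rid k H (lTensor H f.ofConv t))
    (comul_mul_tmul_one hr x)
  simp only [rid_lTensor_mul_tmul_one, rid_lTensor_mul_one_tmul] at this
  exact this

/-- `S(x) (Λ₁ f(Λ₂)) = Λ₁ f(x Λ₂)` for a left integral `Λ`. -/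
theorem antipode_mul_hitLeft {Λ : H} (hl : ∀ x, x * Λ = counit (R := k) x • Λ)
    (f : WithConv (H →ₗ[k] k)) (x : H) :
    antipode k x * hitLeft f Λ = hitLeft (toConv (f.ofConv ∘ₗ mulLeft k x)) Λ := by
  have := congrArg (fun t => TensorProduct.rid k H (lTensor H f.ofConv t))
    (tmul_one_mul_comul hl x)
  simp only [rid_lTensor_tmul_one_mul, rid_lTensor_one_tmul_mul] at this
  exact this

variable (k) in
/-- The left tensor legs `Λ₁ f(Λ₂)` of `Δ(Λ)`. -/
noncomputable def leftLegs (Λ : H) : Submodule k H where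
  carrier := {y | ∃ f : WithConv (H →ₗ[k] k), hitLeft f Λ = y}
  add_mem' := by
    rintro _ _ ⟨f, rfl⟩ ⟨g, rfl⟩
    exact ⟨f + g, by simp [hitLeft, lTensor_add]⟩
  zero_mem' := ⟨0, by simp [hitLeft]⟩
  smul_mem' := by
    rintro c _ ⟨f, rfl⟩
    exact ⟨c • f, by simp [hitLeft, lTensor_smul]⟩

theorem leftLegs_le_span (Λ : H) :
    leftLegs k Λ ≤ Submodule.span k ((ℛ k Λ).left '' (ℛ k Λ).index) := by
  rintro _ ⟨f, rfl⟩
  rw [hitLeft, comp_apply, comp_apply, ← (ℛ k Λ).eq]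
  simp only [map_sum, lTensor_tmul, LinearEquiv.coe_coe, TensorProduct.rid_tmul]
  exact Submodule.sum_mem _ fun i hi =>
    Submodule.smul_mem _ _ (Submodule.subset_span ⟨i, hi, rfl⟩)

/-- The left legs of a normalized right integral form a right ideal, which contains
`Λ₁ S(Λ₂) = 1`. -/
theorem leftLegs_eq_top {Λ : H} (hr : ∀ x, Λ * x = counit (R := k) x • Λ)
    (hε : counit (R := k) Λ = 1) : leftLegs k Λ = ⊤ := by
  set Q := leftLegs k Λ
  have hQ : ∀ y ∈ Q, ∀ x, y * x ∈ Q := by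
    rintro _ ⟨f, rfl⟩ x
    exact ⟨_, (hitLeft_mul hr f x).symm⟩
  suffices h1 : (1 : H) ∈ Q by
    rw [eq_top_iff]
    intro x _
    simpa using hQ 1 h1 x
  -- `Δ(Λ)` lies in `Q ⊗ H`, so `Λ₁ S(Λ₂)` lies in `Q H = Q`
  obtain ⟨p, hp⟩ := Q.subtype.exists_leftInverse_of_injective Q.ker_subtype
  have hpQ : ∀ x ∈ Q, (p x : H) = x := fun x hx =>
    congrArg Subtype.val (LinearMap.congr_fun hp ⟨x, hx⟩)
  have e : rTensor H (Q.subtype ∘ₗ p) (comul (R := k) Λ) = comul Λ := by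
    refine tensor_eq_of_dual fun f g => ?_
    have := congrArg f (hpQ (hitLeft (toConv g) Λ) ⟨_, rfl⟩)
    have h2 : (toConv (f ∘ₗ Q.subtype ∘ₗ p) : WithConv (H →ₗ[k] k)) (hitLeft (toConv g) Λ) =
      (toConv f : WithConv (H →ₗ[k] k)) (hitLeft (toConv g) Λ) := this
    rw [apply_hitLeft, apply_hitLeft] at h2
    rw [convMul_apply, convMul_apply] at h2
    rw [rTensor, ← comp_apply (TensorProduct.map f g), ← TensorProduct.map_comp, comp_id]
    exact h2
  have h := HopfAlgebra.mul_antipode_lTensor_comul_apply (R := k) Λ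
  rw [hε, map_one, ← e] at h
  rw [← h]
  generalize (comul Λ : H ⊗[k] H) = t
  induction t with
  | zero => simp
  | tmul u v => simpa using hQ _ (p u).2 _
  | add s t hs ht => simpa using Q.add_mem hs ht

theorem exists_hitLeft_eq {Λ : H} (hr : ∀ x, Λ * x = counit (R := k) x • Λ)
    (hε : counit (R := k) Λ = 1) (y : H) : ∃ f : WithConv (H →ₗ[k] k), hitLeft f Λ = y := by
  have : y ∈ leftLegs k Λ := leftLegs_eq_top hr hε ▸ Submodule.mem_top
  exact this

variable (k H) in
/-- A semisimple Hopf algebra is finite-dimensional. -/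
theorem finiteDimensional_of_isSemisimpleRing [IsSemisimpleRing H] : FiniteDimensional k H := by
  obtain ⟨Λ, hε, -, hr⟩ := exists_integral k H
  refine ⟨(Submodule.fg_def).mpr ⟨_, (ℛ k Λ).index.finite_toSet.image (ℛ k Λ).left, ?_⟩⟩
  rw [eq_top_iff, ← leftLegs_eq_top hr hε]
  exact leftLegs_le_span Λ

end Integral

/-! ### The trace functional as an integral of the dual -/

section TraceIntegral

open HopfAlgebra (antipode)

variable {k H : Type*} [Field k] [Ring H] [HopfAlgebra k H]

variable (k H) in
/-- The functional `x ↦ Tr(h ↦ S²(h) x)`, an integral of the dual of a finite-dimensional Hopf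
algebra. -/
noncomputable def traceIntegral : WithConv (H →ₗ[k] k) :=
  toConv (trace k H ∘ₗ lcomp k H (antipode k ∘ₗ antipode k) ∘ₗ (LinearMap.mul k H).flip)

theorem traceIntegral_apply (x : H) :
    traceIntegral k H x = trace k H (mulRight k x ∘ₗ antipode k ∘ₗ antipode k) := rfl

theorem traceIntegral_of_left_integral [FiniteDimensional k H] {Λ : H}
    (hl : ∀ x, x * Λ = counit (R := k) x • Λ) : traceIntegral k H Λ = counit (R := k) Λ := by
  rw [traceIntegral_apply]
  have : mulRight k Λ ∘ₗ antipode k ∘ₗ antipode k = (counit (R := k) (A := H)).smulRight Λ := by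
    ext x
    simp [hl]
  rw [this, trace_smulRight]

theorem traceIntegral_one :
    traceIntegral k H 1 = trace k H (antipode k ∘ₗ antipode k) := by
  rw [traceIntegral_apply, mulRight_one, id_comp]

/-- `(1 ⊗ S(h₂)) Δ(S²(h₁)) = S²(h) ⊗ 1`. -/
theorem sum_tmul_antipode_mul_comul_antipode {h : H} {ι : Type*} (r : Coalgebra.Repr k h ι) :
    ∑ i ∈ r.index, (1 ⊗ₜ[k] antipode k (r.right i)) *
      comul (R := k) (antipode k (antipode k (r.left i))) =
      antipode k (antipode k h) ⊗ₜ[k] 1 := by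
  have e := congrArg (fun f : WithConv (H →ₗ[k] H ⊗[k] H) => f (antipode k h))
    (convRight_mul_comul_antipode (k := k) (H := H))
  simp only [convMul_apply, comul_antipode (k := k) h, ← r.eq] at e
  simpa [convRight_apply, convLeft_apply] using e

theorem map_eq_sum_coord {ι V W : Type*} [Fintype ι] [AddCommGroup V] [Module k V]
    [AddCommGroup W] [Module k W] (b : Module.Basis ι k V) (φ : V →ₗ[k] W) (v : V) :
    φ v = ∑ j, b.coord j v • φ (b j) := by
  conv_lhs => rw [← b.sum_repr v]
  simp only [map_sum, map_smul, Module.Basis.coord_apply]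

/-- The operator `h ↦ S²(h) (x₁ f(x₂))` is a sum of composites `f_j ⇀ (S²(g_j ⇀ h) x)`, where
`f(S(v) y) = ∑ g_j(v) f_j(y)`. -/
theorem mulRight_hitLeft_comp_antipode_antipode [FiniteDimensional k H] (f : WithConv (H →ₗ[k] k)) (x : H) :
    mulRight k (hitLeft f x) ∘ₗ antipode k ∘ₗ antipode k =
      ∑ j, hitLeft (toConv (f.ofConv ∘ₗ mulLeft k (antipode k (Module.finBasis k H j)))) ∘ₗ
        (mulRight k x ∘ₗ antipode k ∘ₗ antipode k) ∘ₗ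
          hitLeft (toConv ((Module.finBasis k H).coord j)) := by
  set b := Module.finBasis k H
  ext h
  have h1 : ∀ j, hitLeft (toConv (b.coord j)) h =
      ∑ i ∈ (ℛ k h).index, b.coord j ((ℛ k h).right i) • (ℛ k h).left i := fun j => by
    rw [hitLeft, comp_apply, comp_apply]
    conv_lhs => rw [← (ℛ k h).eq]
    simp
  have h2 : ∀ (v y : H), hitLeft (toConv (f.ofConv ∘ₗ mulLeft k v)) y =
      TensorProduct.rid k H (lTensor H f.ofConv ((1 ⊗ₜ v) * comul y)) := fun v y => by
    rw [rid_lTensor_one_tmul_mul]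
    rfl
  have h3 : antipode k (antipode k h) * hitLeft f x =
      TensorProduct.rid k H (lTensor H f.ofConv
        ((antipode k (antipode k h) ⊗ₜ 1) * comul x)) := by
    rw [rid_lTensor_tmul_one_mul]
    rfl
  simp only [comp_apply, mulRight_apply, LinearMap.sum_apply, h3, h2, h1]
  rw [← sum_tmul_antipode_mul_comul_antipode (ℛ k h), Finset.sum_mul]
  simp only [map_sum, map_smul, Finset.sum_mul, Finset.mul_sum, smul_mul_assoc, mul_smul_comm]
  rw [Finset.sum_comm]
  refine Finset.sum_congr rfl fun i _ => ?_
  conv_lhs => rw [map_eq_sum_coord b (antipode k) ((ℛ k h).right i)]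
  simp only [TensorProduct.tmul_sum, TensorProduct.tmul_smul, Finset.sum_mul, smul_mul_assoc,
    map_sum, map_smul, Bialgebra.comul_mul, mul_assoc]

/-- The trace functional is a right integral of the convolution algebra: cyclicity of the trace
brings the two hits `g_j ⇀` and `f_j ⇀` together, where `∑ g_j * f_j = f(1) ε`. -/
theorem traceIntegral_mul [FiniteDimensional k H] (f : WithConv (H →ₗ[k] k)) :
    traceIntegral k H * f = f 1 • traceIntegral k H := by
  set b := Module.finBasis k H with hb
  have hsum : ∑ j, toConv (b.coord j) * toConv (f.ofConv ∘ₗ mulLeft k (antipode k (b j))) =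
      f 1 • (1 : WithConv (H →ₗ[k] k)) := by
    ext y
    have h5 := congrArg f.ofConv (HopfAlgebra.sum_antipode_mul_eq_smul (R := k) (ℛ k y))
    rw [ofConv_sum, LinearMap.sum_apply]
    simp only [(ℛ k y).convMul_apply]
    rw [Finset.sum_comm]
    rw [map_smul, map_sum] at h5
    simp only [ofConv_smul, LinearMap.smul_apply, convOne_apply, smul_eq_mul]
    rw [mul_comm]
    refine Eq.trans (Finset.sum_congr rfl fun i _ => ?_) h5
    rw [map_eq_sum_coord b (antipode k), Finset.sum_mul, map_sum]
    simp
  ext x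
  rw [← apply_hitLeft, traceIntegral_apply, mulRight_hitLeft_comp_antipode_antipode, map_sum]
  have : ∀ j, trace k H (hitLeft (toConv (f.ofConv ∘ₗ mulLeft k (antipode k (b j)))) ∘ₗ
        (mulRight k x ∘ₗ antipode k ∘ₗ antipode k) ∘ₗ hitLeft (toConv (b.coord j))) =
      trace k H ((mulRight k x ∘ₗ antipode k ∘ₗ antipode k) ∘ₗ
        hitLeft (toConv (b.coord j) * toConv (f.ofConv ∘ₗ mulLeft k (antipode k (b j))))) :=
    fun j => by
      rw [trace_comp_comm', comp_assoc]
      congr 2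
      ext y
      exact hitLeft_hitLeft _ _ y
  have e : ∑ j, (mulRight k x ∘ₗ antipode k ∘ₗ antipode k) ∘ₗ
      hitLeft (toConv (b.coord j) * toConv (f.ofConv ∘ₗ mulLeft k (antipode k (b j)))) =
      f 1 • (mulRight k x ∘ₗ antipode k ∘ₗ antipode k) := by
    ext y
    have h7 : ∑ j, hitLeft
        (toConv (b.coord j) * toConv (f.ofConv ∘ₗ mulLeft k (antipode k (b j)))) y = f 1 • y := by
      refine eq_of_forall_conv k fun h => ?_
      have h6 := congrArg (fun q => (h * q).ofConv y) hsum
      simp only [Finset.mul_sum, ofConv_sum, LinearMap.sum_apply, mul_smul_comm, mul_one] at h6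
      rw [map_sum]
      simp only [apply_hitLeft]
      rw [h6]
      simp
    rw [LinearMap.sum_apply]
    simp only [comp_apply]
    rw [← map_sum, ← map_sum, ← map_sum, h7]
    simp
  rw [Finset.sum_congr rfl fun j _ => this j, ← map_sum, e, map_smul]
  rfl

end TraceIntegral

/-! ### The Frobenius form and the square of the antipode -/

section Frobenius

open HopfAlgebra (antipode)

variable {k H : Type*} [Field k] [Ring H] [HopfAlgebra k H] {Λ : H} {lam : WithConv (H →ₗ[k] k)}

theorem apply_hitLeft_integral (hlam : ∀ f : WithConv (H →ₗ[k] k), lam * f = f 1 • lam)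
    (hΛlam : lam Λ = 1) (f : WithConv (H →ₗ[k] k)) : lam (hitLeft f Λ) = f 1 := by
  rw [apply_hitLeft, hlam, ofConv_smul, LinearMap.smul_apply, hΛlam, smul_eq_mul, mul_one]

/-- `λ(S(x) Λ₁) Λ₂ = x`. -/
theorem apply_antipode_mul_hitLeft (hlam : ∀ f : WithConv (H →ₗ[k] k), lam * f = f 1 • lam)
    (hΛlam : lam Λ = 1) (hl : ∀ x, x * Λ = counit (R := k) x • Λ)
    (f : WithConv (H →ₗ[k] k)) (x : H) : lam (antipode k x * hitLeft f Λ) = f x := by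
  rw [antipode_mul_hitLeft hl, apply_hitLeft_integral hlam hΛlam]
  simp

/-- `λ(Λ₁ x) Λ₂ = S(x)`. -/
theorem apply_hitLeft_mul (hlam : ∀ f : WithConv (H →ₗ[k] k), lam * f = f 1 • lam)
    (hΛlam : lam Λ = 1) (hr : ∀ x, Λ * x = counit (R := k) x • Λ)
    (f : WithConv (H →ₗ[k] k)) (x : H) : lam (hitLeft f Λ * x) = f (antipode k x) := by
  rw [hitLeft_mul hr, apply_hitLeft_integral hlam hΛlam]
  simp

theorem antipode_surjective [FiniteDimensional k H]
    (hlam : ∀ f : WithConv (H →ₗ[k] k), lam * f = f 1 • lam)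
    (hΛlam : lam Λ = 1) (hl : ∀ x, x * Λ = counit (R := k) x • Λ) :
    Function.Surjective (antipode k (A := H)) := by
  refine LinearMap.surjective_of_injective ((injective_iff_map_eq_zero _).mpr fun x hx => ?_)
  refine eq_of_forall_conv k fun f => ?_
  rw [← apply_antipode_mul_hitLeft hlam hΛlam hl f x, hx, zero_mul, map_zero, map_zero]

/-- The bilinear form `λ(xy)` is nondegenerate. -/
theorem eq_zero_of_integral_mul [FiniteDimensional k H]
    (hlam : ∀ f : WithConv (H →ₗ[k] k), lam * f = f 1 • lam)
    (hΛlam : lam Λ = 1) (hl : ∀ x, x * Λ = counit (R := k) x • Λ) {y : H}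
    (hy : ∀ z, lam (y * z) = 0) : y = 0 := by
  obtain ⟨x, rfl⟩ := antipode_surjective hlam hΛlam hl y
  suffices x = 0 by rw [this, map_zero]
  refine eq_of_forall_conv k fun f => ?_
  rw [← apply_antipode_mul_hitLeft hlam hΛlam hl f x, hy, map_zero]

/-- `S²` is the Nakayama automorphism of the form `λ(xy)`. -/
theorem integral_mul_comm (hlam : ∀ f : WithConv (H →ₗ[k] k), lam * f = f 1 • lam)
    (hΛlam : lam Λ = 1) (hl : ∀ x, x * Λ = counit (R := k) x • Λ)
    (hr : ∀ x, Λ * x = counit (R := k) x • Λ) (hε : counit (R := k) Λ = 1) (y x : H) :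
    lam (y * x) = lam (antipode k (antipode k x) * y) := by
  obtain ⟨f, rfl⟩ := exists_hitLeft_eq hr hε y
  rw [apply_hitLeft_mul hlam hΛlam hr, apply_antipode_mul_hitLeft hlam hΛlam hl]

/-- `f(x₁) λ(x₂) = f(g) λ(x)` for `g = Λ₁ λ(Λ₂)`: the left side is again a right integral, and a
right integral `μ` is determined by `μ(Λ)`. -/
theorem mul_integral (hlam : ∀ f : WithConv (H →ₗ[k] k), lam * f = f 1 • lam)
    (hΛlam : lam Λ = 1) (hr : ∀ x, Λ * x = counit (R := k) x • Λ) (hε : counit (R := k) Λ = 1)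
    (f : WithConv (H →ₗ[k] k)) : f * lam = f (hitLeft lam Λ) • lam := by
  ext y
  obtain ⟨h, rfl⟩ := exists_hitLeft_eq hr hε y
  change (f * lam) (hitLeft h Λ) = (f (hitLeft lam Λ) • lam) (hitLeft h Λ)
  rw [apply_hitLeft, mul_assoc, hlam, mul_smul_comm, ofConv_smul, LinearMap.smul_apply,
    ofConv_smul, LinearMap.smul_apply, apply_hitLeft_integral hlam hΛlam, ← apply_hitLeft,
    smul_eq_mul, smul_eq_mul, mul_comm]

/-- The distinguished element `g = Λ₁ λ(Λ₂)` is grouplike. -/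
theorem isGroupLikeElem_hitLeft (hlam : ∀ f : WithConv (H →ₗ[k] k), lam * f = f 1 • lam)
    (hΛlam : lam Λ = 1) (hr : ∀ x, Λ * x = counit (R := k) x • Λ) (hε : counit (R := k) Λ = 1) :
    IsGroupLikeElem k (hitLeft lam Λ) := by
  have hm := mul_integral hlam hΛlam hr hε
  have hmΛ : ∀ f : WithConv (H →ₗ[k] k), (f * lam) Λ = f (hitLeft lam Λ) := fun f => by
    rw [apply_hitLeft]
  constructor
  · have := hmΛ 1
    rw [one_mul, hΛlam] at this
    exact this.symm
  · refine tensor_eq_of_dual fun f g => ?_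
    have e : ((toConv f : WithConv (H →ₗ[k] k)) * toConv g) (hitLeft lam Λ) =
        f (hitLeft lam Λ) * g (hitLeft lam Λ) := by
      rw [← hmΛ, mul_assoc, hm (toConv g), mul_smul_comm, hm (toConv f), ofConv_smul,
        ofConv_smul, LinearMap.smul_apply, LinearMap.smul_apply, hΛlam, smul_eq_mul, smul_eq_mul,
        mul_one, mul_comm]
    simpa using e

/-- Radford's formula `S⁴(y) = g y g⁻¹` for a unimodular finite-dimensional Hopf algebra. -/
theorem antipode_pow_four_mul [FiniteDimensional k H]
    (hlam : ∀ f : WithConv (H →ₗ[k] k), lam * f = f 1 • lam)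
    (hΛlam : lam Λ = 1) (hl : ∀ x, x * Λ = counit (R := k) x • Λ)
    (hr : ∀ x, Λ * x = counit (R := k) x • Λ) (hε : counit (R := k) Λ = 1) (y : H) :
    antipode k (antipode k (antipode k (antipode k y))) * hitLeft lam Λ = hitLeft lam Λ * y := by
  have hg : ∀ x, lam (hitLeft lam Λ * x) = lam (antipode k x) :=
    apply_hitLeft_mul hlam hΛlam hr lam
  have hN := integral_mul_comm hlam hΛlam hl hr hε
  refine sub_eq_zero.mp (eq_zero_of_integral_mul hlam hΛlam hl fun x => ?_)
  rw [sub_mul, map_sub, sub_eq_zero, mul_assoc, mul_assoc, hg (y * x), ← hN, mul_assoc, hg,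
    HopfAlgebra.antipode_mul_antidistrib, HopfAlgebra.antipode_mul_antidistrib, ← hN]

/-- A grouplike element of a finite-dimensional Hopf algebra has finite order, since distinct
grouplike elements are linearly independent. -/
theorem exists_pow_eq_one_of_isGroupLikeElem [FiniteDimensional k H] {g : H}
    (hg : IsGroupLikeElem k g) : ∃ n, 0 < n ∧ g ^ n = 1 := by
  have : Finite (GroupLike k H) := (linearIndep_groupLikeVal (R := k) (A := H)).finite
  obtain ⟨n, hn, h⟩ := (isOfFinOrder_of_finite (⟨g, hg⟩ : GroupLike k H)).exists_pow_eq_one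
  exact ⟨n, hn, by simpa using congrArg GroupLike.val h⟩

end Frobenius

/-! ### Traces on products of matrix algebras -/

section MatrixTrace

open scoped Matrix ComplexOrder

/-- A complex matrix of finite order is unitarizable, so `tr(v⁻¹)` is the conjugate of `tr(v)`. -/
theorem trace_of_mul_eq_one_of_pow_eq_one {n : Type*} [Fintype n] [DecidableEq n]
    {v w : Matrix n n ℂ} (hwv : w * v = 1) {m : ℕ} (hm : 0 < m) (hv : v ^ m = 1) :
    w.trace = star v.trace := by
  -- the positive definite form invariant under `v`
  let P : Matrix n n ℂ := ∑ j ∈ Finset.range m, (v ^ j)ᴴ * v ^ j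
  have hinv : vᴴ * P * v = P := by
    have h1 : vᴴ * P * v = ∑ j ∈ Finset.range m, (v ^ (j + 1))ᴴ * v ^ (j + 1) := by
      simp only [P, Finset.mul_sum, Finset.sum_mul]
      refine Finset.sum_congr rfl fun j _ => ?_
      rw [pow_succ, Matrix.conjTranspose_mul]
      simp only [mul_assoc]
    have h2 := Finset.sum_range_succ (fun j => (v ^ j)ᴴ * v ^ j) m
    rw [Finset.sum_range_succ'] at h2
    rw [h1]
    simpa [hv, P] using h2
  have hP : P.PosDef := by
    have : P = (∑ j ∈ (Finset.range m).erase 0, (v ^ j)ᴴ * v ^ j) + 1 := by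
      simp only [P]
      rw [← Finset.sum_erase_add _ _ (Finset.mem_range.mpr hm)]
      simp
    rw [this]
    refine Matrix.PosDef.posSemidef_add ?_ Matrix.PosDef.one
    exact Matrix.posSemidef_sum _ fun j _ => Matrix.posSemidef_conjTranspose_mul_self _
  have hu : IsUnit P.det := (Matrix.isUnit_iff_isUnit_det _).mp hP.isUnit
  have hvw : v * w = 1 := mul_eq_one_comm.mp hwv
  have hw : w = P⁻¹ * (vᴴ * P) := by
    have : vᴴ * P = P * w := by
      rw [← mul_one (vᴴ * P), ← hvw, ← mul_assoc, hinv]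
    rw [this, Matrix.nonsing_inv_mul_cancel_left _ _ hu]
  rw [hw, Matrix.trace_mul_comm, Matrix.mul_assoc, Matrix.mul_nonsing_inv _ hu, mul_one,
    Matrix.trace_conjTranspose]

variable {ι : Type*} [Fintype ι] [DecidableEq ι] {n : ι → Type*} [∀ i, Fintype (n i)]
  [∀ i, DecidableEq (n i)]

theorem trace_mulLeft_comp_mulRight {k : Type*} [Field k] (a b : Π i, Matrix (n i) (n i) k) :
    trace k (Π i, Matrix (n i) (n i) k) (mulLeft k a ∘ₗ mulRight k b) =
      ∑ i, (a i).trace * (b i).trace := by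
  let B := Pi.basis fun i => Matrix.stdBasis k (n i) (n i)
  rw [trace_eq_matrix_trace k B, Matrix.trace, Fintype.sum_sigma]
  refine Finset.sum_congr rfl fun i _ => ?_
  rw [Fintype.sum_prod_type, Matrix.trace, Matrix.trace, Finset.sum_mul_sum]
  refine Finset.sum_congr rfl fun p _ => Finset.sum_congr rfl fun q _ => ?_
  rw [Matrix.diag_apply, LinearMap.toMatrix_apply]
  simp only [B, Pi.basis_apply, Pi.basis_repr, comp_apply, mulRight_apply, mulLeft_apply,
    Matrix.stdBasis_eq_single]
  rw [Pi.mul_apply, Pi.mul_apply, Pi.single_eq_same]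
  have e : ∀ M : Matrix (n i) (n i) k, (Matrix.stdBasis k (n i) (n i)).repr M (p, q) = M p q :=
    fun M => rfl
  rw [e, Matrix.mul_apply, Finset.sum_eq_single p]
  · simp
  · intro r _ hr
    rw [Matrix.single_mul_apply_of_ne _ _ _ _ _ hr, mul_zero]
  · simp

/-- Every functional on a product of matrix algebras is `x ↦ ∑ᵢ tr(uᵢ xᵢ)` for some `u`. -/
theorem exists_trace_mul_eq {k : Type*} [Field k] (f : (Π i, Matrix (n i) (n i) k) →ₗ[k] k) :
    ∃ u : Π i, Matrix (n i) (n i) k, ∀ x, f x = ∑ i, (u i * x i).trace := by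
  let B := Pi.basis fun i => Matrix.stdBasis k (n i) (n i)
  let u : Π i, Matrix (n i) (n i) k := fun i => Matrix.of fun p q => f (B ⟨i, q, p⟩)
  let F : (Π i, Matrix (n i) (n i) k) →ₗ[k] k :=
    ∑ i, Matrix.traceLinearMap (n i) k k ∘ₗ mulLeft k (u i) ∘ₗ LinearMap.proj i
  have hF : ∀ x, F x = ∑ i, (u i * x i).trace := fun x => by
    simp [F, LinearMap.sum_apply]
  refine ⟨u, fun x => ?_⟩
  rw [← hF]
  revert x
  rw [← LinearMap.ext_iff]
  refine B.ext ?_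
  rintro ⟨i, p, q⟩
  rw [hF, Finset.sum_eq_single i]
  · simp [B, Pi.basis_apply, Matrix.stdBasis_eq_single, u]
    simp [Matrix.trace_mul_single]
  · intro j _ hj
    simp [B, Pi.basis_apply, hj]
  · simp


/-- Let `u` be invertible in a product of complex matrix algebras with `u² g` central for some `g`
of finite order. On each factor `u` is then a scalar multiple of a matrix `v` of finite order, so
conjugation by `u` has trace `∑ |tr v|²`, which is nonzero once some component of `u` has nonzero
trace. -/
theorem trace_conj_ne_zero {u u' g : Π i, Matrix (n i) (n i) ℂ} (huu : u' * u = 1)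
    {m : ℕ} (hm : 0 < m) (hg : g ^ m = 1)
    (hc : ∀ x, u ^ 2 * g * x = x * (u ^ 2 * g)) (htr : ∃ i, (u i).trace ≠ 0) :
    trace ℂ (Π i, Matrix (n i) (n i) ℂ) (mulLeft ℂ u' ∘ₗ mulRight ℂ u) ≠ 0 := by
  rw [trace_mulLeft_comp_mulRight]
  have hgu : IsUnit g := IsUnit.of_pow_eq_one hg hm.ne'
  have key : ∀ i, ∃ r : ℝ, 0 ≤ r ∧ (u' i).trace * (u i).trace = r ∧
      ((u i).trace ≠ 0 → 0 < r) := by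
    intro i
    have huui : u' i * u i = 1 := congrFun huu i
    obtain ⟨c, hcc⟩ : ∃ c : ℂ, u i ^ 2 * g i = Matrix.scalar (n i) c := by
      obtain ⟨c, h⟩ := Matrix.mem_range_scalar_of_commute_single (M := u i ^ 2 * g i)
        fun p q _ => by
          have := congrFun (hc (Pi.single i (Matrix.single p q 1))) i
          simpa [Commute, SemiconjBy] using this.symm
      exact ⟨c, h.symm⟩
    rcases isEmpty_or_nonempty (n i) with hn | hn
    · exact ⟨0, le_rfl, by simp [Matrix.trace], by simp [Matrix.trace]⟩
    -- `u ^ 2 * g` is the scalar `s ^ 2` here, so `v = s⁻¹ • u` satisfies `v ^ 2 * g = 1`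
    obtain ⟨s, hs⟩ := IsAlgClosed.exists_pow_nat_eq c (n := 2) two_pos
    have hs0 : s ≠ 0 := by
      rintro rfl
      rw [← hs] at hcc
      have h1 : IsUnit (u i ^ 2 * g i) :=
        ((IsUnit.of_mul_eq_one_right _ huui).pow 2).mul (hgu.map (Pi.evalMonoidHom _ i))
      rw [hcc] at h1
      simp at h1
    let v := s⁻¹ • u i
    let w := s • u' i
    have hwv : w * v = 1 := by simp [v, w, smul_smul, hs0, huui]
    have hvg : v ^ 2 * g i = 1 := by
      simp only [v]
      rw [smul_pow, smul_mul_assoc, hcc, ← hs, Matrix.scalar_apply, ← Matrix.smul_one_eq_diagonal,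
        smul_smul, ← mul_pow, inv_mul_cancel₀ hs0, one_pow, one_smul]
    have hgv : v ^ (2 * m) = 1 := by
      have h2 : Commute (v ^ 2) (g i) := by
        have := mul_eq_one_comm.mp hvg
        rw [Commute, SemiconjBy, hvg, this]
      have := h2.mul_pow m
      rw [hvg, one_pow, ← pow_mul, show g i ^ m = 1 from congrFun hg i, mul_one] at this
      exact this.symm
    have h3 := trace_of_mul_eq_one_of_pow_eq_one hwv (by omega) hgv
    have h4 : (u' i).trace * (u i).trace = w.trace * v.trace := by
      simp only [v, w, Matrix.trace_smul, smul_eq_mul]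
      field_simp
    refine ⟨‖v.trace‖ ^ 2, by positivity, ?_, fun hne => ?_⟩
    · rw [h4, h3]
      simpa using Complex.conj_mul' v.trace
    · have : v.trace ≠ 0 := by simp [v, hs0, hne]
      positivity
  choose r hr0 hr hrpos using key
  simp only [hr]
  rw [← Complex.ofReal_sum]
  obtain ⟨i, hi⟩ := htr
  exact Complex.ofReal_ne_zero.mpr
    (Finset.sum_pos' (fun i _ => hr0 i) ⟨i, Finset.mem_univ i, hrpos i hi⟩).ne'

end MatrixTrace

/-! ### Positivity of the trace of the squared antipode -/

section LarsonRadford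

open HopfAlgebra (antipode)

theorem eq_zero_of_sum_trace_mul {k ι : Type*} [Field k] [Fintype ι] [DecidableEq ι]
    {n : ι → Type*} [∀ i, Fintype (n i)] [∀ i, DecidableEq (n i)] {M : Π i, Matrix (n i) (n i) k}
    (h : ∀ y : Π i, Matrix (n i) (n i) k, ∑ i, (M i * y i).trace = 0) : M = 0 := by
  funext i
  refine Matrix.ext_iff_trace_mul_right.mpr fun y => ?_
  have := h (Pi.single i y)
  rw [Finset.sum_eq_single i] at this
  · simpa using this
  · intro j _ hj
    simp [hj]
  · simp

variable (H : Type*) [Ring H] [HopfAlgebra ℂ H] [IsSemisimpleRing H]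

/-- `Tr(S²) ≠ 0` for a semisimple complex Hopf algebra: on the simple factors of `H`, `S²` is
conjugation by matrices that are of finite order up to scalars. -/
theorem trace_antipode_antipode_ne_zero :
    trace ℂ H (antipode ℂ ∘ₗ antipode ℂ) ≠ 0 := by
  have := finiteDimensional_of_isSemisimpleRing ℂ H
  obtain ⟨Λ, hε, hl, hr⟩ := exists_integral ℂ H
  set lam := traceIntegral ℂ H
  have hlam : ∀ f : WithConv (H →ₗ[ℂ] ℂ), lam * f = f 1 • lam := traceIntegral_mul
  have hΛlam : lam Λ = 1 := (traceIntegral_of_left_integral hl).trans hε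
  obtain ⟨N, d, -, ⟨ψ⟩⟩ := IsSemisimpleRing.exists_algEquiv_pi_matrix_of_isAlgClosed ℂ H
  obtain ⟨u, hu⟩ := exists_trace_mul_eq (lam.ofConv ∘ₗ ψ.symm.toLinearMap)
  have hu' : ∀ x, lam x = ∑ i, (u i * ψ x i).trace := fun x => by
    have := hu (ψ x)
    simpa using this
  have hN := integral_mul_comm hlam hΛlam hl hr hε
  -- `S²` is conjugation by the density `u` of the integral with respect to the trace
  have hconj : ∀ x, ψ x * u = u * ψ (antipode ℂ (antipode ℂ x)) := fun x => by
    refine sub_eq_zero.mp (eq_zero_of_sum_trace_mul fun y => ?_)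
    have h1 := hN (ψ.symm y) x
    rw [hu', hu', map_mul, map_mul, AlgEquiv.apply_symm_apply] at h1
    have h2 : ∑ i, ((ψ x * u) i * y i).trace = ∑ i, (u i * (y * ψ x) i).trace :=
      Finset.sum_congr rfl fun i _ => by
        rw [Pi.mul_apply, Pi.mul_apply, mul_assoc, Matrix.trace_mul_comm, mul_assoc]
    simp only [Pi.sub_apply, sub_mul, Matrix.trace_sub, Finset.sum_sub_distrib]
    rw [h2, h1, sub_eq_zero]
    simp only [Pi.mul_apply, mul_assoc]
  have hinj : ∀ z, u * z = 0 → z = 0 := fun z hz => by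
    have : ψ.symm z = 0 := eq_zero_of_integral_mul hlam hΛlam hl fun y => by
      rw [hu', map_mul, AlgEquiv.apply_symm_apply]
      refine Finset.sum_eq_zero fun i _ => ?_
      rw [Pi.mul_apply, ← mul_assoc, ← Pi.mul_apply, hz]
      simp
    simpa using this
  obtain ⟨u', huu⟩ : ∃ u', u * u' = 1 :=
    LinearMap.surjective_of_injective (f := mulLeft ℂ u)
      ((injective_iff_map_eq_zero _).mpr hinj) 1
  have huu' : u' * u = 1 := by
    refine sub_eq_zero.mp (hinj _ ?_)
    rw [mul_sub, ← mul_assoc, huu, one_mul, mul_one, sub_self]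
  obtain ⟨m, hm, hg⟩ := exists_pow_eq_one_of_isGroupLikeElem
    (isGroupLikeElem_hitLeft hlam hΛlam hr hε)
  set g := hitLeft lam Λ with hgdef
  have hcentral : ∀ x, u ^ 2 * ψ g * x = x * (u ^ 2 * ψ g) := fun x => by
    obtain ⟨x, rfl⟩ := ψ.surjective x
    have h4 := congrArg ψ (antipode_pow_four_mul hlam hΛlam hl hr hε x)
    rw [map_mul, map_mul, ← hgdef] at h4
    rw [mul_assoc, ← h4, sq, mul_assoc, ← mul_assoc u (ψ _) (ψ g), ← hconj, ← mul_assoc,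
      ← mul_assoc, ← hconj]
    simp only [mul_assoc]
  -- `Λ` is central, so each of its components is scalar, while `∑ tr(uᵢ Λᵢ) = λ(Λ) = 1`
  have htr : ∃ i, (u i).trace ≠ 0 := by
    by_contra! h0
    have h1 := hu' Λ
    rw [hΛlam, Finset.sum_eq_zero] at h1
    · exact one_ne_zero h1
    intro i _
    obtain ⟨c, hc⟩ := Matrix.mem_range_scalar_of_commute_single (M := ψ Λ i) fun p q _ => by
      have h2 : ψ Λ * Pi.single i (Matrix.single p q 1) =
          Pi.single i (Matrix.single p q 1) * ψ Λ := by
        obtain ⟨x, hx⟩ := ψ.surjective (Pi.single i (Matrix.single p q 1))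
        rw [← hx, ← map_mul, ← map_mul, hl, hr]
      simpa [Commute, SemiconjBy] using (congrFun h2 i).symm
    rw [← hc, Matrix.scalar_apply, ← Matrix.smul_one_eq_diagonal, mul_smul_comm, mul_one,
      Matrix.trace_smul, h0, smul_zero]
  have hS : mulLeft ℂ u' ∘ₗ mulRight ℂ u =
      ψ.toLinearEquiv.conj (antipode ℂ ∘ₗ antipode ℂ) := by
    refine LinearMap.ext fun x => ?_
    obtain ⟨x, rfl⟩ := ψ.surjective x
    simp [LinearEquiv.conj_apply, hconj, ← mul_assoc, huu']
  rw [← LinearMap.trace_conj' _ ψ.toLinearEquiv, ← hS]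
  exact trace_conj_ne_zero huu' hm (by rw [← map_pow, hg, map_one]) hcentral htr

/-- The dual of a semisimple complex Hopf algebra has a normalized integral. -/
theorem exists_dual_integral :
    ∃ lam : WithConv (H →ₗ[ℂ] ℂ), lam 1 = 1 ∧ ∀ f : WithConv (H →ₗ[ℂ] ℂ), lam * f = f 1 • lam := by
  have := finiteDimensional_of_isSemisimpleRing ℂ H
  have h0 := trace_antipode_antipode_ne_zero H
  rw [← traceIntegral_one] at h0
  refine ⟨(traceIntegral ℂ H 1)⁻¹ • traceIntegral ℂ H, ?_, fun f => ?_⟩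
  · rw [ofConv_smul, LinearMap.smul_apply, smul_eq_mul, inv_mul_cancel₀ h0]
  · rw [smul_mul_assoc, traceIntegral_mul, smul_comm]

end LarsonRadford

/-! ### Semisimplicity of the dual algebra -/

section Separable

open HopfAlgebra (antipode)

/-- An algebra with a separability idempotent `∑ᵢ aᵢ ⊗ bᵢ` is semisimple: averaging over it turns
linear projections onto submodules into equivariant ones. -/
theorem isSemisimpleRing_of_separability {k A ι : Type*} [Field k] [Ring A] [Algebra k A]
    [Fintype ι] (a b : ι → A) (hab : ∑ i, a i * b i = 1)
    (hcomm : ∀ x, ∑ i, (x * a i) ⊗ₜ[k] b i = ∑ i, a i ⊗ₜ[k] (b i * x)) : IsSemisimpleRing A := by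
  refine (isSemisimpleModule_iff A A).mpr ⟨fun I => ?_⟩
  obtain ⟨p, hp⟩ := (I.restrictScalars k).subtype.exists_leftInverse_of_injective
    (Submodule.ker_subtype _)
  have hpI : ∀ x (hx : x ∈ I), p x = ⟨x, hx⟩ := fun x hx => LinearMap.congr_fun hp ⟨x, hx⟩
  have key : ∀ x v : A, x * ∑ i, a i * (p (b i * v) : A) = ∑ i, a i * (p (b i * (x * v)) : A) := by
    intro x v
    have := congrArg (LinearMap.mul' k A ∘ₗ
      lTensor A ((I.restrictScalars k).subtype ∘ₗ p ∘ₗ mulRight k v)) (hcomm x)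
    simpa [Finset.mul_sum, mul_assoc] using this
  let q : A →ₗ[A] I :=
    { toFun := fun v => ⟨∑ i, a i * (p (b i * v) : A),
        I.sum_mem fun i _ => I.smul_mem _ (p (b i * v)).2⟩
      map_add' := fun v w => by
        ext
        simp [mul_add, Finset.sum_add_distrib]
      map_smul' := fun x v => by
        ext
        simp [key] }
  refine ⟨LinearMap.ker q, LinearMap.isCompl_of_proj fun x => ?_⟩
  ext
  have : ∀ i, a i * (p (b i * (x : A)) : A) = a i * b i * x := fun i => by
    rw [hpI (b i * x) (I.smul_mem _ x.2), mul_assoc]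
  simp only [q, LinearMap.coe_mk, AddHom.coe_mk, this]
  rw [← Finset.sum_mul, hab, one_mul]

variable {k H : Type*} [Field k] [Ring H] [HopfAlgebra k H]

theorem lid_rTensor_tmul_one_mul (f : H →ₗ[k] k) (t : H ⊗[k] H) (x : H) :
    TensorProduct.lid k H (rTensor H f ((x ⊗ₜ 1) * t)) =
      TensorProduct.lid k H (rTensor H (f ∘ₗ mulLeft k x) t) := by
  induction t with
  | zero => simp
  | tmul u v => simp
  | add s t hs ht => simp only [mul_add, map_add, hs, ht]

theorem lid_rTensor_one_tmul_mul (f : H →ₗ[k] k) (t : H ⊗[k] H) (x : H) :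
    TensorProduct.lid k H (rTensor H f ((1 ⊗ₜ x) * t)) =
      x * TensorProduct.lid k H (rTensor H f t) := by
  induction t with
  | zero => simp
  | tmul u v => simp
  | add s t hs ht => simp only [mul_add, map_add, hs, ht]

/-- `λ(S(x) y₁) y₂ = x₁ λ(S(x₂) y)` for a right integral `λ`. -/
theorem hitRight_integral_antipode {lam : WithConv (H →ₗ[k] k)}
    (hlam : ∀ f : WithConv (H →ₗ[k] k), lam * f = f 1 • lam) (x y : H) :
    hitRight (toConv (lam.ofConv ∘ₗ mulLeft k (antipode k x))) y =
      hitLeft (toConv (lam.ofConv ∘ₗ mulRight k y ∘ₗ antipode k)) x := by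
  have hl : ∀ z, hitRight lam z = lam z • (1 : H) := fun z => by
    refine eq_of_forall_conv k fun f => ?_
    rw [apply_hitRight, hlam, map_smul, ofConv_smul, LinearMap.smul_apply, smul_eq_mul,
      smul_eq_mul, mul_comm]
  have e := congrArg (fun f : WithConv (H →ₗ[k] H ⊗[k] H) => f x)
    (convRight_mul_comul_antipode (k := k) (H := H))
  simp only [(ℛ k x).convMul_apply] at e
  have e2 := congrArg (fun t => TensorProduct.lid k H (rTensor H lam.ofConv (t * comul y))) e
  simp only [convRight_apply, convLeft_apply, comp_apply] at e2
  rw [lid_rTensor_tmul_one_mul] at e2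
  refine e2.symm.trans ?_
  rw [hitLeft, comp_apply, comp_apply]
  conv_rhs => rw [← (ℛ k x).eq]
  simp only [map_sum, Finset.sum_mul]
  refine Finset.sum_congr rfl fun i _ => ?_
  rw [mul_assoc, ← Bialgebra.comul_mul, lid_rTensor_one_tmul_mul]
  have := hl (antipode k ((ℛ k x).right i) * y)
  rw [hitRight, comp_apply, comp_apply] at this
  erw [this]
  simp

/-- If the dual of a finite-dimensional Hopf algebra has a normalized integral `λ`, then it is
semisimple, with separability idempotent the bilinear form `λ(S(x) y)`. -/
theorem isSemisimpleRing_dual [FiniteDimensional k H] {lam : WithConv (H →ₗ[k] k)}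
    (hlam : ∀ f : WithConv (H →ₗ[k] k), lam * f = f 1 • lam) (h1 : lam 1 = 1) :
    IsSemisimpleRing (WithConv (H →ₗ[k] k)) := by
  let B := Module.finBasis k H
  let a : Fin (Module.finrank k H) → WithConv (H →ₗ[k] k) := fun i =>
    toConv (lam.ofConv ∘ₗ mulRight k (B i) ∘ₗ antipode k)
  let b : Fin (Module.finrank k H) → WithConv (H →ₗ[k] k) := fun i => toConv (B.coord i)
  have hform : ∀ x y, ∑ i, a i x * b i y = lam (antipode k x * y) := fun x y => by
    refine Eq.trans ?_ (map_eq_sum_coord B (lam.ofConv ∘ₗ mulLeft k (antipode k x)) y).symm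
    exact Finset.sum_congr rfl fun i _ => mul_comm _ _
  refine isSemisimpleRing_of_separability (k := k) a b ?_ fun f => ?_
  · ext x
    rw [ofConv_sum, LinearMap.sum_apply]
    simp only [(ℛ k x).convMul_apply]
    rw [Finset.sum_comm]
    simp only [hform]
    rw [← map_sum, HopfAlgebra.sum_antipode_mul_eq_smul, map_smul, h1]
    simp
  -- by finite-dimensionality, tensors over the dual are tested on pairs of elements of `H`
  · have hinj : ∀ s t : WithConv (H →ₗ[k] k) ⊗[k] WithConv (H →ₗ[k] k),
        (∀ x y : H, mul' k k (TensorProduct.map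
          (LinearMap.applyₗ x ∘ₗ (WithConv.linearEquiv k (H →ₗ[k] k)).toLinearMap)
          (LinearMap.applyₗ y ∘ₗ (WithConv.linearEquiv k (H →ₗ[k] k)).toLinearMap) s) =
         mul' k k (TensorProduct.map
          (LinearMap.applyₗ x ∘ₗ (WithConv.linearEquiv k (H →ₗ[k] k)).toLinearMap)
          (LinearMap.applyₗ y ∘ₗ (WithConv.linearEquiv k (H →ₗ[k] k)).toLinearMap) t)) → s = t := by
      intro s t h
      have hev : ∀ F : WithConv (H →ₗ[k] k) →ₗ[k] k, ∃ x : H, F =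
          LinearMap.applyₗ x ∘ₗ (WithConv.linearEquiv k (H →ₗ[k] k)).toLinearMap := fun F => by
        obtain ⟨x, hx⟩ := (Module.evalEquiv k H).surjective
          (F ∘ₗ (WithConv.linearEquiv k (H →ₗ[k] k)).symm.toLinearMap)
        refine ⟨x, LinearMap.ext fun f => ?_⟩
        have := LinearMap.congr_fun hx f.ofConv
        simpa using this.symm
      refine tensor_eq_of_dual fun F G => ?_
      obtain ⟨x, rfl⟩ := hev F
      obtain ⟨y, rfl⟩ := hev G
      exact h x y
    refine hinj _ _ fun x y => ?_
    simp only [map_sum, TensorProduct.map_tmul, mul'_apply, comp_apply, LinearEquiv.coe_coe,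
      WithConv.linearEquiv_apply, LinearMap.applyₗ_apply_apply]
    have h2 := congrArg f.ofConv (hitRight_integral_antipode hlam x y)
    rw [apply_hitRight, apply_hitLeft, ← apply_hitLeft, ← apply_hitRight] at h2
    simp only [← apply_hitLeft]
    have h3 : ∀ i, f (hitLeft (a i) x) = a i (hitRight f x) := fun i => by
      rw [apply_hitLeft, apply_hitRight]
    simp only [h3, hform]
    exact h2.symm

end Separable

/-! ### Stability under the antipode -/

section AntipodeStable

open HopfAlgebra (antipode)

/-- A subalgebra of a finite-dimensional algebra is closed under inverses. -/
theorem mem_subalgebra_of_mul_eq_one {k E : Type*} [Field k] [Ring E] [Algebra k E]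
    [FiniteDimensional k E] (P : Subalgebra k E) {a b : E} (ha : a ∈ P) (hba : b * a = 1) : b ∈ P := by
  have hinj : Function.Injective (mulLeft k (⟨a, ha⟩ : P)) :=
    (injective_iff_map_eq_zero _).mpr fun c hc => by
      have h1 : a * (c : E) = 0 := congrArg Subtype.val hc
      ext
      rw [← one_mul (c : E), ← hba, mul_assoc, h1, mul_zero, ZeroMemClass.coe_zero]
  obtain ⟨c, hc⟩ := LinearMap.surjective_of_injective hinj 1
  have h1 : a * (c : E) = 1 := congrArg Subtype.val hc
  have : b = c := by rw [← mul_one b, ← h1, ← mul_assoc, hba, one_mul]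
  exact this ▸ c.2

variable {k H : Type*} [Field k] [Ring H] [HopfAlgebra k H] [FiniteDimensional k H]

/-- A linear subspace preserved by a subalgebra of the convolution algebra of `H → H` containing
the identity is preserved by the antipode, the convolution inverse of the identity. -/
theorem antipode_mem_of_mul_mem {I : Submodule k H}
    (hmul : ∀ S T : WithConv (H →ₗ[k] H), (∀ x ∈ I, S x ∈ I) → (∀ x ∈ I, T x ∈ I) →
      ∀ x ∈ I, (S * T) x ∈ I)
    (hone : ∀ x ∈ I, algebraMap k H (counit x) ∈ I) {x : H} (hx : x ∈ I) : antipode k x ∈ I := by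
  let P : Subalgebra k (WithConv (H →ₗ[k] H)) :=
    { carrier := {T | ∀ x ∈ I, T x ∈ I}
      mul_mem' := fun {S T} hS hT => hmul S T hS hT
      add_mem' := fun hS hT x hx => I.add_mem (hS x hx) (hT x hx)
      algebraMap_mem' := fun c x hx => by
        rw [convAlgebraMap_apply]
        exact I.smul_mem _ (hone x hx) }
  have : FiniteDimensional k (WithConv (H →ₗ[k] H)) :=
    Module.Finite.equiv (WithConv.linearEquiv k (H →ₗ[k] H)).symm
  have hid : toConv LinearMap.id ∈ P := fun x hx => hx
  exact mem_subalgebra_of_mul_eq_one P hid antipode_mul_id x hx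

/-- A bi-ideal of a finite-dimensional Hopf algebra is a Hopf ideal. -/
theorem antipode_mem_of_isCoideal {I : Ideal H} [I.IsTwoSided] [(I.restrictScalars k).IsCoideal]
    {x : H} (hx : x ∈ I) : antipode k x ∈ I := by
  obtain ⟨hc, hΔ⟩ := (Submodule.isCoideal_iff_comul_mem (I.restrictScalars k)).mp inferInstance
  refine antipode_mem_of_mul_mem (I := I.restrictScalars k) (fun S T hS hT x hx => ?_)
    (fun x hx => by simp [hc x hx]) hx
  rw [convMul_apply]
  obtain ⟨_, ⟨s, rfl⟩, _, ⟨t, rfl⟩, h⟩ := Submodule.mem_sup.mp (hΔ x hx)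
  rw [← h, map_add, map_add]
  refine Submodule.add_mem _ ?_ ?_
  · clear h
    induction s with
    | zero => simp
    | tmul u v => exact I.mul_mem_left _ (hT _ v.2)
    | add u v hu hv => simpa using I.add_mem hu hv
  · clear h
    induction t with
    | zero => simp
    | tmul u v => exact I.mul_mem_right _ (hS _ u.2)
    | add u v hu hv => simpa using I.add_mem hu hv

/-- A sub-bialgebra of a finite-dimensional Hopf algebra is stable under the antipode. -/
theorem antipode_mem_of_comul_mem {K : Subalgebra k H}
    (hK : ∀ a ∈ K, comul (R := k) a ∈ LinearMap.range (TensorProduct.map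
      (Subalgebra.toSubmodule K).subtype (Subalgebra.toSubmodule K).subtype))
    {x : H} (hx : x ∈ K) : antipode k x ∈ K := by
  refine antipode_mem_of_mul_mem (I := Subalgebra.toSubmodule K) (fun S T hS hT x hx => ?_)
    (fun x _ => K.algebraMap_mem _) hx
  rw [convMul_apply]
  obtain ⟨t, h⟩ := hK x hx
  rw [← h]
  clear h
  induction t with
  | zero => simp
  | tmul u v => exact K.mul_mem (hS _ u.2) (hT _ v.2)
  | add u v hu hv => simpa using K.add_mem hu hv

end AntipodeStable

/-! ### Annihilators of tensor powers -/

section TensorPowers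

namespace AlgRep

/-- The matrix coefficient `h ↦ ℓ(h v)` of a representation. -/
noncomputable def coeff {H : Type u} [Ring H] [Algebra ℂ H] (V : AlgRep.{u, v} H)
    (l : V.carrier →ₗ[ℂ] ℂ) (m : V.carrier) : WithConv (H →ₗ[ℂ] ℂ) :=
  toConv (l ∘ₗ LinearMap.applyₗ m ∘ₗ V.ρ.toLinearMap)

theorem coeff_apply {H : Type u} [Ring H] [Algebra ℂ H] (V : AlgRep.{u, v} H)
    (l : V.carrier →ₗ[ℂ] ℂ) (m : V.carrier) (h : H) : V.coeff l m h = l (V.ρ h m) := rfl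

theorem mem_ann_iff_coeff {H : Type u} [Ring H] [Algebra ℂ H] (V : AlgRep.{u, v} H) (h : H) :
    h ∈ V.ann ↔ ∀ l m, V.coeff l m h = 0 := by
  simp only [coeff_apply]
  refine (RingHom.mem_ker (f := V.ρ)).trans ⟨fun hh l m => by rw [hh]; simp, fun hh => ?_⟩
  refine LinearMap.ext fun m => ?_
  exact (Module.forall_dual_apply_eq_zero_iff ℂ _).mp fun l => hh l m

variable {H : Type u} [Ring H] [Bialgebra ℂ H]

theorem mem_ann_trivial_iff (h : H) :
    h ∈ (AlgRep.trivial.{u, v} H).ann ↔ counit (R := ℂ) h = 0 := by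
  refine (RingHom.mem_ker (f := (AlgRep.trivial.{u, v} H).ρ)).trans ?_
  have e : (AlgRep.trivial.{u, v} H).ρ h =
      algebraMap ℂ (Module.End ℂ (ULift.{v} ℂ)) (counit (R := ℂ) h) := rfl
  rw [e]
  refine ⟨fun hh => ?_, fun hh => (congrArg _ hh).trans (map_zero _)⟩
  have h1 : algebraMap ℂ (Module.End ℂ (ULift.{v} ℂ)) (counit (R := ℂ) h) (ULift.up 1) = 0 :=
    LinearMap.congr_fun hh (ULift.up 1)
  simpa [Module.algebraMap_end_apply] using congrArg ULift.down h1

theorem tensorAction_coeff {V W : Type v} [AddCommGroup V] [Module ℂ V] [AddCommGroup W]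
    [Module ℂ W] (ρ : H →ₐ[ℂ] Module.End ℂ V) (σ : H →ₐ[ℂ] Module.End ℂ W) (h : H)
    (l : V →ₗ[ℂ] ℂ) (m : V) (l' : W →ₗ[ℂ] ℂ) (m' : W) :
    mul' ℂ ℂ (TensorProduct.map l l' (tensorAction ρ σ h (m ⊗ₜ m'))) =
      mul' ℂ ℂ (TensorProduct.map (l ∘ₗ LinearMap.applyₗ m ∘ₗ ρ.toLinearMap)
        (l' ∘ₗ LinearMap.applyₗ m' ∘ₗ σ.toLinearMap) (comul h)) := by
  have e1 : tensorAction ρ σ h = Module.endTensorEndAlgHom (R := ℂ) (S := ℂ) (A := ℂ)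
      (M := V) (N := W) (Algebra.TensorProduct.map ρ σ (comul h)) := rfl
  rw [e1]
  generalize (comul h : H ⊗[ℂ] H) = t
  induction t with
  | zero => simp
  | tmul a b => simp [Module.endTensorEndAlgHom_apply]
  | add s t hs ht => simp only [map_add, LinearMap.add_apply, hs, ht]

theorem mem_ann_tensor_iff (V W : AlgRep.{u, v} H) (h : H) :
    h ∈ (V.tensor W).ann ↔ ∀ l m, hitRight (V.coeff l m) h ∈ W.ann := by
  have e : ∀ l m l' m', mul' ℂ ℂ (TensorProduct.map l l' (tensorAction V.ρ W.ρ h (m ⊗ₜ m'))) =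
      W.coeff l' m' (hitRight (V.coeff l m) h) := by
    intro l m l' m'
    rw [apply_hitRight]
    exact tensorAction_coeff _ _ _ _ _ _ _
  simp only [mem_ann_iff_coeff W, ← e]
  change tensorAction V.ρ W.ρ h = 0 ↔ _
  refine ⟨fun hh l m l' m' => by simp [hh], fun hh => ?_⟩
  refine TensorProduct.ext' fun m m' => ?_
  exact tensor_eq_zero_of_dual fun l l' => hh l m l' m'

end AlgRep

variable {H : Type u} [Ring H] {M : Type v} [AddCommGroup M] [Module ℂ M] [Module H M]

section Bialgebra

variable [Bialgebra ℂ H] [IsScalarTower ℂ H M]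

theorem mem_tensorAnn_iff (h : H) :
    h ∈ tensorAnn H M ↔ ∀ n, h ∈ ((AlgRep.ofModule H M).pow n).ann := by
  simp [tensorAnn, Submodule.mem_iInf]

theorem mem_ann_pow_zero_iff (h : H) :
    h ∈ ((AlgRep.ofModule H M).pow 0).ann ↔ counit (R := ℂ) h = 0 :=
  AlgRep.mem_ann_trivial_iff h

theorem mem_ann_pow_succ_iff (n : ℕ) (h : H) :
    h ∈ ((AlgRep.ofModule H M).pow (n + 1)).ann ↔
      ∀ l m, hitRight ((AlgRep.ofModule H M).coeff l m) h ∈ ((AlgRep.ofModule H M).pow n).ann :=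
  AlgRep.mem_ann_tensor_iff _ _ h

variable (H M) in
/-- The submonoid of the convolution algebra generated by the matrix coefficients of `M`: the
products of `n` of them are matrix coefficients of `M^{⊗n}`. -/
noncomputable def coeffMonoid : Submonoid (WithConv (H →ₗ[ℂ] ℂ)) :=
  Submonoid.closure {c | ∃ l m, c = (AlgRep.ofModule H M).coeff l m}

/-- `I_M` is the common zero set of the products of matrix coefficients of `M`. -/
theorem mem_tensorAnn_iff_coeffMonoid (h : H) :
    h ∈ tensorAnn H M ↔ ∀ c ∈ coeffMonoid H M, c h = 0 := by
  rw [mem_tensorAnn_iff]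
  constructor
  · intro hh c hc
    induction hc using Submonoid.closure_induction_left generalizing h with
    | one => exact (mem_ann_pow_zero_iff h).mp (hh 0)
    | mul_left d hd c _ ih =>
      obtain ⟨l, m, rfl⟩ := hd
      rw [← apply_hitRight]
      exact ih _ fun n => (mem_ann_pow_succ_iff n h).mp (hh (n + 1)) l m
  · intro hh n
    induction n generalizing h with
    | zero => exact (mem_ann_pow_zero_iff h).mpr (hh 1 (one_mem _))
    | succ n ih =>
      refine (mem_ann_pow_succ_iff n h).mpr fun l m => ih _ fun c hc => ?_
      rw [apply_hitRight]
      exact hh _ (mul_mem (Submonoid.subset_closure ⟨l, m, rfl⟩) hc)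

variable (H M) in
theorem isTwoSided_tensorAnn : (tensorAnn H M).IsTwoSided := by
  refine ⟨fun {a} b ha => ?_⟩
  rw [mem_tensorAnn_iff] at ha ⊢
  intro n
  have h1 : ((AlgRep.ofModule H M).pow n).ρ a = 0 := ha n
  change ((AlgRep.ofModule H M).pow n).ρ (a * b) = 0
  rw [map_mul, h1, zero_mul]

variable (H M) in
theorem isCoideal_tensorAnn : ((tensorAnn H M).restrictScalars ℂ).IsCoideal := by
  have hI := fun h : H => mem_tensorAnn_iff_coeffMonoid (M := M) h
  refine ⟨fun x hx => (hI x).mp hx 1 (one_mem _), fun x hx => ?_⟩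
  refine tensor_eq_zero_of_dual fun f g => ?_
  set F : WithConv (H →ₗ[ℂ] ℂ) := toConv (f ∘ₗ ((tensorAnn H M).restrictScalars ℂ).mkQ)
  set G : WithConv (H →ₗ[ℂ] ℂ) := toConv (g ∘ₗ ((tensorAnn H M).restrictScalars ℂ).mkQ)
  have hF : ∀ y ∈ tensorAnn H M, F y = 0 := fun y hy => by
    have : ((tensorAnn H M).restrictScalars ℂ).mkQ y = 0 := (Submodule.Quotient.mk_eq_zero _).mpr hy
    simp [F, this]
  have hG : ∀ y ∈ tensorAnn H M, G y = 0 := fun y hy => by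
    have : ((tensorAnn H M).restrictScalars ℂ).mkQ y = 0 := (Submodule.Quotient.mk_eq_zero _).mpr hy
    simp [G, this]
  have e : mul' ℂ ℂ (TensorProduct.map f g (TensorProduct.map
      ((tensorAnn H M).restrictScalars ℂ).mkQ ((tensorAnn H M).restrictScalars ℂ).mkQ (comul x))) =
      (F * G) x := by
    simp [F, G, TensorProduct.map_comp]
  rw [e, ← apply_hitLeft]
  refine hF _ ((hI _).mpr fun c hc => ?_)
  rw [apply_hitLeft, ← apply_hitRight]
  refine hG _ ((hI _).mpr fun c' hc' => ?_)
  rw [apply_hitRight]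
  exact (hI x).mp hx _ (mul_mem hc hc')

theorem tensorAnn_le_annihilator : tensorAnn H M ≤ Module.annihilator H M := by
  intro x hx
  rw [Module.mem_annihilator]
  intro m
  refine (Module.forall_dual_apply_eq_zero_iff ℂ _).mp fun l => ?_
  exact (mem_tensorAnn_iff_coeffMonoid x).mp hx _
    (Submonoid.subset_closure ⟨l, m, rfl⟩)

theorem hitRight_mem_of_isCoideal {J : Submodule ℂ H} [J.IsCoideal] {d : WithConv (H →ₗ[ℂ] ℂ)}
    (hd : ∀ y ∈ J, d y = 0) {x : H} (hx : x ∈ J) : hitRight d x ∈ J := by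
  obtain ⟨-, hΔ⟩ := (Submodule.isCoideal_iff_comul_mem J).mp inferInstance
  obtain ⟨_, ⟨s, rfl⟩, _, ⟨t, rfl⟩, h⟩ := Submodule.mem_sup.mp (hΔ x hx)
  rw [hitRight, comp_apply, comp_apply, ← h, map_add, map_add]
  refine Submodule.add_mem _ ?_ ?_
  · clear h
    induction s with
    | zero => simp
    | tmul u v => simpa using J.smul_mem _ v.2
    | add u v hu hv => simpa using J.add_mem hu hv
  · clear h
    induction t with
    | zero => simp
    | tmul u v => simp [hd _ u.2]
    | add u v hu hv => simpa using J.add_mem hu hv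

/-- Every coideal annihilating `M` annihilates all tensor powers of `M`. -/
theorem le_tensorAnn {J : Ideal H} [(J.restrictScalars ℂ).IsCoideal]
    (hJ : J ≤ Module.annihilator H M) : J ≤ tensorAnn H M := by
  intro x hx
  rw [mem_tensorAnn_iff]
  intro n
  induction n generalizing x with
  | zero =>
    exact (mem_ann_pow_zero_iff x).mpr
      (Submodule.IsCoideal.counit_eq_zero (I := J.restrictScalars ℂ) hx)
  | succ n ih =>
    refine (mem_ann_pow_succ_iff n x).mpr fun l (m : M) => ih ?_
    refine hitRight_mem_of_isCoideal (J := J.restrictScalars ℂ) (fun y hy => ?_) hx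
    have : y • m = 0 := Module.mem_annihilator.mp (hJ hy) m
    exact (congrArg l this).trans (map_zero l)

end Bialgebra

theorem isHopfIdeal_tensorAnn [HopfAlgebra ℂ H] [IsScalarTower ℂ H M] [FiniteDimensional ℂ H] :
    (tensorAnn H M).IsHopfIdeal ℂ := by
  have := isTwoSided_tensorAnn H M
  have := isCoideal_tensorAnn H M
  exact { antipode_mem := fun x hx => antipode_mem_of_isCoideal hx }

end TensorPowers

/-! ### Comatrix bases -/

section Cosemisimple

variable {H : Type*} [Ring H] [Bialgebra ℂ H]

theorem hitRight_comatrix {q : ℕ} {x : Matrix (Fin q) (Fin q) H} (hx : IsComatrixBasis x)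
    (f : WithConv (H →ₗ[ℂ] ℂ)) (i j : Fin q) : hitRight f (x i j) = ∑ l, f (x i l) • x l j := by
  rw [hitRight, comp_apply, comp_apply, hx.comul_eq]
  simp

theorem hitLeft_comatrix {q : ℕ} {x : Matrix (Fin q) (Fin q) H} (hx : IsComatrixBasis x)
    (f : WithConv (H →ₗ[ℂ] ℂ)) (i j : Fin q) : hitLeft f (x i j) = ∑ l, f (x l j) • x i l := by
  rw [hitLeft, comp_apply, comp_apply, hx.comul_eq]
  simp

/-- A subspace stable under the right action that contains an irreducible character contains the
whole simple subcoalgebra. -/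
theorem comatrix_mem_of_trace_mem {q : ℕ} {x : Matrix (Fin q) (Fin q) H} (hx : IsComatrixBasis x)
    {B : Submodule ℂ H} (hB : ∀ f : WithConv (H →ₗ[ℂ] ℂ), hitRight f x.trace ∈ B)
    (i j : Fin q) : x i j ∈ B := by
  obtain ⟨f, hf⟩ := exists_dual_of_linearIndependent hx.linearIndependent (j, i)
  have h := hB (toConv f)
  have e : hitRight (toConv f) x.trace = x i j := by
    rw [Matrix.trace, map_sum]
    simp only [Matrix.diag_apply, hitRight_comatrix hx]
    have : ∀ a b, f (x a b) = if a = j ∧ b = i then 1 else 0 := fun a b => by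
      simpa using hf (a, b)
    simp only [this, ite_smul, one_smul, zero_smul, ite_and]
    simp
  rwa [e] at h

/-- If the convolution algebra of a finite-dimensional `H` is semisimple, then every subspace of
`H` stable under both of its actions is spanned by comatrix bases. -/
theorem mem_span_comatrix [FiniteDimensional ℂ H] [IsSemisimpleRing (WithConv (H →ₗ[ℂ] ℂ))]
    {K : Submodule ℂ H} (hl : ∀ f : WithConv (H →ₗ[ℂ] ℂ), ∀ a ∈ K, hitLeft f a ∈ K)
    (hr : ∀ f : WithConv (H →ₗ[ℂ] ℂ), ∀ a ∈ K, hitRight f a ∈ K) {y : H} (hy : y ∈ K) :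
    y ∈ Submodule.span ℂ {z | ∃ (q : ℕ) (x : Matrix (Fin q) (Fin q) H) (i j : Fin q),
      0 < q ∧ IsComatrixBasis x ∧ (∀ a b, x a b ∈ K) ∧ z = x i j} := by
  have : FiniteDimensional ℂ (WithConv (H →ₗ[ℂ] ℂ)) :=
    Module.Finite.equiv (WithConv.linearEquiv ℂ (H →ₗ[ℂ] ℂ)).symm
  obtain ⟨N, d, hd, ⟨φ⟩⟩ :=
    IsSemisimpleRing.exists_algEquiv_pi_matrix_of_isAlgClosed ℂ (WithConv (H →ₗ[ℂ] ℂ))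
  -- the elements of `H` representing the matrix entries of the dual algebra
  have hX : ∀ (n : Fin N) (i j : Fin (d n)), ∃ z : H, ∀ f : WithConv (H →ₗ[ℂ] ℂ),
      f z = φ f n i j := fun n i j => by
    obtain ⟨z, hz⟩ := (Module.evalEquiv ℂ H).surjective
      (Matrix.entryLinearMap ℂ ℂ i j ∘ₗ LinearMap.proj n ∘ₗ φ.toLinearMap ∘ₗ
        (WithConv.linearEquiv ℂ (H →ₗ[ℂ] ℂ)).symm.toLinearMap)
    refine ⟨z, fun f => ?_⟩
    have := LinearMap.congr_fun hz f.ofConv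
    simpa using this
  choose x hx using hX
  let E : ∀ n, Fin (d n) → Fin (d n) → WithConv (H →ₗ[ℂ] ℂ) := fun n i j =>
    φ.symm (Pi.single n (Matrix.single i j 1))
  have hE : ∀ n i j, φ (E n i j) = Pi.single n (Matrix.single i j 1) := fun n i j => by simp [E]
  have hbasis : ∀ n, IsComatrixBasis (Matrix.of (x n)) := fun n => by
    refine ⟨?_, fun i j => ?_, fun i j => ?_⟩
    · rw [Fintype.linearIndependent_iff]
      rintro c hc ⟨i, j⟩
      have h := congrArg (E n i j).ofConv hc
      rw [map_sum, map_zero, Finset.sum_eq_single (i, j)] at h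
      · simpa [hx, hE] using h
      · rintro ⟨a, b⟩ _ hab
        have : ¬ (i = a ∧ j = b) := fun h => hab (by rw [h.1, h.2])
        simp [hx, hE, this]
      · simp
    · refine tensor_eq_of_dual fun f g => ?_
      have h1 : ((toConv f : WithConv (H →ₗ[ℂ] ℂ)) * toConv g) (x n i j) =
          ∑ l, f (x n i l) * g (x n l j) := by
        rw [hx, map_mul, Pi.mul_apply, Matrix.mul_apply]
        exact Finset.sum_congr rfl fun l _ => by rw [← hx, ← hx]
      simpa using h1
    · have h1 := hx n i j 1
      rw [map_one, convOne_apply] at h1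
      simpa [Matrix.one_apply] using h1
  have hsum : y = ∑ n, ∑ i, ∑ j, E n i j y • x n i j := by
    refine eq_of_forall_conv ℂ fun p => ?_
    have hp : p = ∑ n, ∑ i, ∑ j, φ p n i j • E n i j := by
      apply φ.injective
      simp only [map_sum, map_smul, hE]
      funext n
      rw [Finset.sum_apply, Finset.sum_eq_single n]
      · simp only [Finset.sum_apply, Pi.smul_apply, Pi.single_eq_same, Matrix.smul_single,
          smul_eq_mul, mul_one]
        exact Matrix.matrix_eq_sum_single _
      · intro m _ hm
        simp [Finset.sum_apply, Pi.single_eq_of_ne hm.symm]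
      · simp
    conv_lhs => rw [hp]
    simp [LinearMap.sum_apply, hx, mul_comm]
  -- hitting with matrix units moves the `(i, j)` coefficient of `y` to every entry of its block
  have hmem : ∀ n i j, E n i j y ≠ 0 → ∀ a b, x n a b ∈ K := fun n i j h0 a b => by
    have h1 : hitLeft (E n b j) (hitRight (E n i a) y) = E n i j y • x n a b := by
      refine eq_of_forall_conv ℂ fun p => ?_
      have h2 : E n i a * (p * E n b j) = φ p n a b • E n i j := by
        apply φ.injective
        rw [map_mul, map_mul, map_smul, hE, hE, hE]
        funext m
        rcases eq_or_ne m n with rfl | hm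
        · simp [← mul_assoc]
        · simp [hm]
      rw [apply_hitLeft, apply_hitRight, h2, map_smul, hx, ofConv_smul, LinearMap.smul_apply,
        smul_eq_mul, smul_eq_mul, mul_comm]
    rw [← inv_smul_smul₀ h0 (x n a b), ← h1]
    exact K.smul_mem _ (hl _ _ (hr _ _ hy))
  rw [hsum]
  refine Submodule.sum_mem _ fun n _ => Submodule.sum_mem _ fun i _ =>
    Submodule.sum_mem _ fun j _ => ?_
  rcases eq_or_ne (E n i j y) 0 with h0 | h0
  · rw [h0, zero_smul]
    exact Submodule.zero_mem _
  · exact Submodule.smul_mem _ _ (Submodule.subset_span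
      ⟨d n, Matrix.of (x n), i, j, Nat.pos_of_ne_zero (hd n).out, hbasis n, hmem n i j h0, rfl⟩)

end Cosemisimple

/-! ### The Hopf kernel -/

section HopfKernel

variable {A B : Type*} [Ring A] [Ring B] [Bialgebra ℂ A] [Bialgebra ℂ B]

theorem lid_rTensor_map {U V W : Type*} [AddCommGroup U] [Module ℂ U] [AddCommGroup V] [Module ℂ V]
    [AddCommGroup W] [Module ℂ W] (F : U →ₗ[ℂ] ℂ) (Ψ : V →ₗ[ℂ] W) (t : U ⊗[ℂ] V) :
    TensorProduct.lid ℂ W (rTensor W F (lTensor U Ψ t)) =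
      Ψ (TensorProduct.lid ℂ V (rTensor V F t)) := by
  induction t with
  | zero => simp
  | tmul x y => simp
  | add s t hs ht => simp only [map_add, hs, ht]

theorem rid_lTensor_map {U V W : Type*} [AddCommGroup U] [Module ℂ U] [AddCommGroup V] [Module ℂ V]
    [AddCommGroup W] [Module ℂ W] (F : U →ₗ[ℂ] ℂ) (Ψ : V →ₗ[ℂ] W) (t : V ⊗[ℂ] U) :
    TensorProduct.rid ℂ W (lTensor W F (rTensor U Ψ t)) =
      Ψ (TensorProduct.rid ℂ V (lTensor V F t)) := by
  induction t with
  | zero => simp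
  | tmul x y => simp
  | add s t hs ht => simp only [map_add, hs, ht]

/-- Evaluating the outer tensor factors at arbitrary functionals, `a` lies in `HKer(f)` iff
`f(b) = ε(b) 1` for all `b` in the subcoalgebra generated by `a`. -/
theorem mem_hopfKer_iff (f : A →ₐc[ℂ] B) (a : A) :
    a ∈ hopfKer f ↔ ∀ F G : WithConv (A →ₗ[ℂ] ℂ),
      f (hitLeft G (hitRight F a)) = G (hitRight F a) • (1 : B) := by
  let Ψ : A →ₗ[ℂ] B ⊗[ℂ] A := rTensor A (f : A →ₐ[ℂ] B).toLinearMap ∘ₗ comul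
  let Φ : A →ₗ[ℂ] B ⊗[ℂ] A := (Algebra.TensorProduct.includeRight : A →ₐ[ℂ] B ⊗[ℂ] A).toLinearMap
  have hmid : comulMid f a = lTensor A Ψ (comul a) := rfl
  have hone : comulOne A B a = lTensor A Φ (comul a) := rfl
  have h1 : ∀ F G : WithConv (A →ₗ[ℂ] ℂ), TensorProduct.rid ℂ B (lTensor B G.ofConv
      (TensorProduct.lid ℂ _ (rTensor _ F.ofConv (comulMid f a)))) =
      f (hitLeft G (hitRight F a)) := fun F G => by
    rw [hmid, lid_rTensor_map]
    exact rid_lTensor_map G.ofConv (f : A →ₐ[ℂ] B).toLinearMap _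
  have h2 : ∀ F G : WithConv (A →ₗ[ℂ] ℂ), TensorProduct.rid ℂ B (lTensor B G.ofConv
      (TensorProduct.lid ℂ _ (rTensor _ F.ofConv (comulOne A B a)))) =
      G (hitRight F a) • (1 : B) := fun F G => by
    rw [hone, lid_rTensor_map]
    simp [Φ, hitRight]
  change comulMid f a = comulOne A B a ↔ _
  refine ⟨fun h F G => by rw [← h1, ← h2, h], fun h => ?_⟩
  refine tensor_eq_of_dual fun F P => ?_
  rw [← apply_lid_rTensor, ← apply_lid_rTensor]
  congr 1
  refine tensor_eq_of_dual fun Q G => ?_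
  rw [← apply_rid_lTensor, ← apply_rid_lTensor]
  congr 1
  exact (h1 (toConv F) (toConv G)).trans ((h _ _).trans (h2 (toConv F) (toConv G)).symm)

theorem hitLeft_mem_hopfKer {f : A →ₐc[ℂ] B} {a : A} (ha : a ∈ hopfKer f)
    (P : WithConv (A →ₗ[ℂ] ℂ)) : hitLeft P a ∈ hopfKer f := by
  rw [mem_hopfKer_iff] at ha ⊢
  intro F G
  rw [← hitLeft_hitRight, hitLeft_hitLeft, ha, apply_hitLeft]

theorem hitRight_mem_hopfKer {f : A →ₐc[ℂ] B} {a : A} (ha : a ∈ hopfKer f)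
    (P : WithConv (A →ₗ[ℂ] ℂ)) : hitRight P a ∈ hopfKer f := by
  rw [mem_hopfKer_iff] at ha ⊢
  intro F G
  rw [hitRight_hitRight, ha]

theorem map_eq_counit_of_mem_hopfKer {f : A →ₐc[ℂ] B} {a : A} (ha : a ∈ hopfKer f) :
    f a = counit (R := ℂ) a • (1 : B) := by
  have h := (mem_hopfKer_iff f a).mp ha 1 1
  rwa [hitRight_one, hitLeft_one] at h

/-- The Hopf kernel contains every comatrix basis mapped to the identity matrix. -/
theorem comatrix_mem_hopfKer {f : A →ₐc[ℂ] B} {q : ℕ} {x : Matrix (Fin q) (Fin q) A}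
    (hx : IsComatrixBasis x) (hf : ∀ i j, f (x i j) = if i = j then 1 else 0) (i j : Fin q) :
    x i j ∈ hopfKer f := by
  rw [mem_hopfKer_iff]
  intro F G
  simp only [hitRight_comatrix hx, hitLeft_comatrix hx, map_sum, map_smul, hf, smul_ite, smul_zero]
  simp [Finset.sum_smul, smul_smul]

theorem isHopfSubalgebra_hopfKer {A B : Type*} [Ring A] [Ring B] [HopfAlgebra ℂ A]
    [Bialgebra ℂ B] [FiniteDimensional ℂ A] (f : A →ₐc[ℂ] B) : IsHopfSubalgebra (hopfKer f) := by
  have h : ∀ a ∈ hopfKer f, comul (R := ℂ) a ∈ LinearMap.range (TensorProduct.map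
      (Subalgebra.toSubmodule (hopfKer f)).subtype (Subalgebra.toSubmodule (hopfKer f)).subtype) :=
    fun a ha => comul_mem_of_hit_mem (K := Subalgebra.toSubmodule (hopfKer f))
      (fun P _ hb => hitLeft_mem_hopfKer hb P) (fun P _ hb => hitRight_mem_hopfKer hb P) ha
  exact ⟨h, fun a ha => antipode_mem_of_comul_mem h ha⟩

end HopfKernel

/-! ### Comatrix bases acting trivially -/

section Main

variable {H : Type*} [Ring H] {M : Type*} [AddCommGroup M] [Module ℂ M] [Module H M]

theorem hitRight_one_eq [Bialgebra ℂ H] (d : WithConv (H →ₗ[ℂ] ℂ)) :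
    hitRight d (1 : H) = d 1 • (1 : H) := by
  rw [hitRight, comp_apply, comp_apply, Bialgebra.comul_one, Algebra.TensorProduct.one_def]
  simp

/-- A comatrix basis acting on `M` as the identity matrix does so on all tensor powers of `M`. -/
theorem comatrix_sub_mem_tensorAnn [Bialgebra ℂ H] [IsScalarTower ℂ H M] {q : ℕ}
    {x : Matrix (Fin q) (Fin q) H} (hx : IsComatrixBasis x)
    (hM : ∀ i j, ∀ m : M, x i j • m = if i = j then m else 0) (i j : Fin q) :
    x i j - (if i = j then 1 else 0) ∈ tensorAnn H M := by
  rw [mem_tensorAnn_iff]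
  intro n
  induction n with
  | zero =>
    rw [mem_ann_pow_zero_iff, map_sub, hx.counit_eq]
    split <;> simp
  | succ n ih =>
    refine (mem_ann_pow_succ_iff n _).mpr fun l (m : M) => ?_
    set c := (AlgRep.ofModule H M).coeff l m
    have hc : ∀ a b, c (x a b) = if a = b then l m else 0 := fun a b => by
      have : c (x a b) = l (x a b • m) := rfl
      rw [this, hM]
      split
      · rfl
      · exact map_zero l
    have hc1 : c 1 = l m := by
      have : c 1 = l ((1 : H) • m) := rfl
      rw [this, one_smul]
    have e : hitRight c (x i j - if i = j then 1 else 0) =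
        algebraMap ℂ H (l m) * (x i j - if i = j then 1 else 0) := by
      rw [← Algebra.smul_def, map_sub, hitRight_comatrix hx, smul_sub]
      split <;> simp [hc, hitRight_one_eq, hc1]
    rw [e]
    exact Ideal.mul_mem_left _ _ ih

end Main

theorem theorem2p10 {H : Type*} [Ring H] [HopfAlgebra ℂ H] [IsSemisimpleRing H]
    {M : Type*} [AddCommGroup M] [Module ℂ M] [Module H M] [IsScalarTower ℂ H M] :
    ∃ (_ : (tensorAnn H M).IsTwoSided) (_ : (tensorAnn H M).IsHopfIdeal ℂ),
      IsGreatest {J : Ideal H | J.IsTwoSided ∧ J.IsHopfIdeal ℂ ∧ J ≤ Module.annihilator H M}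
        (tensorAnn H M) ∧
      repKer H M = hopfKer (Bialgebra.Quotient.mkBialgHom (R := ℂ) (tensorAnn H M)) := by
  have := finiteDimensional_of_isSemisimpleRing ℂ H
  have h1 := isTwoSided_tensorAnn H M
  have h2 : (tensorAnn H M).IsHopfIdeal ℂ := isHopfIdeal_tensorAnn
  refine ⟨h1, h2, ⟨⟨h1, h2, tensorAnn_le_annihilator⟩, fun J ⟨_, hJ, hJM⟩ => le_tensorAnn hJM⟩, ?_⟩
  set π := Bialgebra.Quotient.mkBialgHom (R := ℂ) (tensorAnn H M)
  obtain ⟨lam, hlam1, hlam⟩ := exists_dual_integral H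
  have := isSemisimpleRing_dual hlam hlam1
  apply le_antisymm
  · refine sInf_le ⟨isHopfSubalgebra_hopfKer π, ?_⟩
    rintro _ ⟨q, x, -, hx, rfl, hM⟩
    refine Subalgebra.sum_mem _ fun i _ => comatrix_mem_hopfKer hx (fun a b => ?_) i i
    have h := comatrix_sub_mem_tensorAnn hx hM a b
    rw [← Ideal.Quotient.eq_zero_iff_mem, map_sub, sub_eq_zero] at h
    refine h.trans ?_
    split <;> simp
  · refine le_sInf ?_
    rintro B ⟨hB, hker⟩ y hy
    have hspan := mem_span_comatrix (K := Subalgebra.toSubmodule (hopfKer π))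
      (fun P _ hb => hitLeft_mem_hopfKer hb P) (fun P _ hb => hitRight_mem_hopfKer hb P) hy
    suffices Submodule.span ℂ _ ≤ Subalgebra.toSubmodule B from this hspan
    rw [Submodule.span_le]
    rintro _ ⟨q, x, i, j, hq, hx, hxK, rfl⟩
    have hchar : x.trace ∈ kerChar H M := by
      refine ⟨q, x, hq, hx, rfl, fun a b m => ?_⟩
      have h3 := map_eq_counit_of_mem_hopfKer (f := π) (hxK a b)
      rw [hx.counit_eq] at h3
      have h4 : x a b - (if a = b then 1 else 0) ∈ tensorAnn H M := by
        rw [← Ideal.Quotient.eq_zero_iff_mem, map_sub, sub_eq_zero]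
        refine h3.trans ?_
        split <;> simp
      have h5 := Module.mem_annihilator.mp (tensorAnn_le_annihilator h4) m
      rw [sub_smul, sub_eq_zero] at h5
      rw [h5]
      split <;> simp
    exact comatrix_mem_of_trace_mem hx
      (fun f => hitRight_mem_of_comul_mem (hB.comul_mem _ (hker hchar)) f) i j
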